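/- Let $\mathbb T^n=\mathbb R^n/\mathbb Z^n$ be the flat $n$-torus with Lebesgue measure $dx$ normalised to total mass one, and let $\Delta=-\sum_j\partial_j^2$ be its Hodge Laplacian on functions, with the orthonormal basis of eigenfunctions $h_m(x)=e^{2\pi i m\cdot x}$, $m\in\mathbb Z^n$, $\Delta h_m=\lambda_m h_m$, $\lambda_m=4\pi^2|m|^2$. For a bounded function $g$ on $\mathbb R$ let $g(\Delta)$ be the bounded operator on $L^2(\mathbb T^n)$ with $g(\Delta)h_m=g(\lambda_m)h_m$, and let $G(\Delta)^s=(G^s)(\Delta)$. For a compact operator $T$ on a Hilbert space $H$ with singular values $\mu_1(T)\ge\mu_2(T)\ge\dots$ let $\gamma(T)_k=\frac{1}{\log(1+k)}\sum_{j=1}^k\mu_j(T)$, $k\ge1$; $T\in\mathcal L^1$ (trace class) means $\sum_j\mu_j(T)<\infty$, and $T\in\mathcal L^{1,\infty}$ means $\sup_k\gamma(T)_k<\infty$. Let $BL$ be the set of Banach limits, i.e. of the translation invariant states on $\ell^\infty$. Let $DL_2$ be the set of states $\omega$ on $\ell^\infty$ with $\liminf_k a_k\le\omega(a)\le\limsup_k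 a_k$ for all bounded $a\ge0$ and $\omega(\{\gamma(T)_{\lceil k/2\rceil}\}_k)=\omega(\gamma(T))$ for all positive $T\in\mathcal L^{1,\infty}$. A positive $T\in\mathcal L^{1,\infty}$ is called measurable (in the sense of Connes) if $\omega(\gamma(T))$ has the same value for all $\omega\in DL_2$. For a measurable function $f$ on $\mathbb T^n$, let $M_f$ be multiplication by $f$. For a bounded operator $R\ge 0$ the product $RM_fR$ is understood in the sense of quadratic forms: it is the bounded operator $S$ on $L^2(\mathbb T^n)$, if there is one, with $\langle u,Sv\rangle=\int_{\mathbb T^n}\overline{(Ru)(x)}\,f(x)\,(Rv)(x)\,dx$ for all $u,v\in L^2(\mathbb T^n)$, where all these integrals converge absolutely. (For $f\ge0$ this is $|M_{\sqrt f}R|^2$, with $M_{\sqrt f}R$ bounded.) **Corollary.** Let $G\ge0$ be a bounded Borel function such that $G(\Delta)\in\mathcal L^{1,\infty}(L^2(\mathbb T^n))$, $G(\Delta)\neq0$, and $G(\Delta)$ is measurable. Then, for every measurable $f:\mathbb T^n\to\mathbb C$, $$G(\Delta)^{s/2}M_{|f|}G(\Delta)^{s/2}\in\mathcal L^1\ \text{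 for all } s>1\quad\Longleftrightarrow\quad f\in L^1(\mathbb T^n).$$ Moreover, $G(\Delta)^s\in\mathcal L^1$ for all $s>1$, the limit $c=\lim_{k\to\infty}\frac1k\operatorname{Tr}\big(G(\Delta)^{1+1/k}\big)$ exists and is finite, $c\ge0$, and for every complex-valued $f\in L^1(\mathbb T^n)$ the operators $G(\Delta)^{s/2}M_fG(\Delta)^{s/2}$, $s>1$, are trace class, with $$\lim_{k\to\infty}\frac1k\operatorname{Tr}\Big(G(\Delta)^{\frac{1+1/k}2}M_f\,G(\Delta)^{\frac{1+1/k}2}\Big)=c\int_{\mathbb T^n}f(x)\,dx .$$ The sequence under this limit is bounded, and every $\xi\in BL$ takes the same value $c\int_{\mathbb T^n}f(x)\,dx$ on it. -/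

import Mathlib

open MeasureTheory Filter Topology
open scoped ENNReal ComplexOrder ComplexConjugate InnerProductSpace

noncomputable section

namespace TorusResidue

/-! ## Singular values, trace class operators, the ideal `L^{1,∞}` -/

section Ideals

variable {H : Type*} [NormedAddCommGroup H] [InnerProductSpace ℂ H] [CompleteSpace H]

/-- The singular values of a bounded operator on a Hilbert space, in decreasing order and with
multiplicity, given as approximation numbers: `singVal T k` is the distance in operator norm
from `T` to the operators of rank at most `k`.  The numbering starts at `0`, so `singVal T k` is
the singular value usually called `μ_{k+1}(T)`. -/
def singVal (T : H →L[ℂ] H) (k : ℕ) : ℝ :=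
  sInf ((fun F : H →L[ℂ] H => ‖T - F‖) '' {F | (F : H →ₗ[ℂ] H).rank ≤ (k : Cardinal)})

/-- `T` is trace class: compact, with `∑ μ_k(T) < ∞`. -/
def IsTraceClass (T : H →L[ℂ] H) : Prop :=
  IsCompactOperator T ∧ Summable (singVal T)

/-- The trace `∑ ⟨b i, T (b i)⟩` of an operator, computed in an orthonormal basis `b`
(for a trace class operator the series converges absolutely, to a value that does not depend
on `b`). -/
def trace {ι : Type*} (b : HilbertBasis ι ℂ H) (T : H →L[ℂ] H) : ℂ :=
  ∑' i, ⟪b i, T (b i)⟫_ℂ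

/-- The sequence `γ(T) = { log(1+k)⁻¹ ∑_{j=1}^k μ_j(T) }_{k ≥ 1}`; the index `i` of the code is
`k - 1`. -/
def gammaSeq (T : H →L[ℂ] H) (i : ℕ) : ℂ :=
  (((Real.log (1 + ((i + 1 : ℕ) : ℝ)))⁻¹ * ∑ j ∈ Finset.range (i + 1), singVal T j : ℝ) : ℂ)

/-- `T ∈ L^{1,∞}`: `T` is compact and `sup_k log(1+k)⁻¹ ∑_{j=1}^k μ_j(T) < ∞`. -/
def MemL1Inf (T : H →L[ℂ] H) : Prop :=
  IsCompactOperator T ∧ Memℓp (gammaSeq T) ∞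

end Ideals

/-! ## States on `ℓ^∞` -/

/-- The space `ℓ^∞` of bounded complex sequences.  A sequence `{a_k}_{k ≥ 1}` is indexed by
`i = k - 1`. -/
abbrev EllInfty : Type := lp (fun _ : ℕ => ℂ) ∞

/-- The translation `T_j : {a_k} ↦ {a_{k+j}}`. -/
def shift (j : ℕ) (a : EllInfty) : EllInfty :=
  ⟨fun i => a (i + j), memℓp_infty (by
    obtain ⟨C, hC⟩ := (lp.memℓp a).bddAbove
    exact ⟨C, by rintro _ ⟨i, rfl⟩; exact hC ⟨i + j, rfl⟩⟩)⟩

/-- The dilation `D_2 : {a_k} ↦ {a_⌈k/2⌉}`.  For `k = i + 1` one has `⌈k/2⌉ = i / 2 + 1`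
(natural number division), which is the index `i / 2` of the code. -/
def dilateTwo (a : EllInfty) : EllInfty :=
  ⟨fun i => a (i / 2), memℓp_infty (by
    obtain ⟨C, hC⟩ := (lp.memℓp a).bddAbove
    exact ⟨C, by rintro _ ⟨i, rfl⟩; exact hC ⟨i / 2, rfl⟩⟩)⟩

/-- `ω` is a state on `ℓ^∞`: a positive functional with `ω(1) = 1`. -/
structure IsState (ω : EllInfty →L[ℂ] ℂ) : Prop where
  pos : ∀ a : EllInfty, (∀ k, 0 ≤ a k) → 0 ≤ ω a
  map_one : ω 1 = 1

/-- The set `BL` of Banach limits: translation invariant states on `ℓ^∞`. -/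
def IsBanachLimit (ω : EllInfty →L[ℂ] ℂ) : Prop :=
  IsState ω ∧ ∀ (j : ℕ) (a : EllInfty), ω (shift j a) = ω a

/-- The set `DL₂` of the states `ω` on `ℓ^∞` with `liminf a ≤ ω(a) ≤ limsup a` for every bounded
sequence `a ≥ 0`, and with `ω(D_2 γ(T)) = ω(γ(T))` for every positive `T ∈ L^{1,∞}(H)`. -/
def IsDL2 (H : Type*) [NormedAddCommGroup H] [InnerProductSpace ℂ H] [CompleteSpace H]
    (ω : EllInfty →L[ℂ] ℂ) : Prop :=
  IsState ω ∧
  (∀ a : EllInfty, (∀ k, 0 ≤ a k) →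
    liminf (fun k => (a k).re) atTop ≤ (ω a).re ∧
    (ω a).re ≤ limsup (fun k => (a k).re) atTop) ∧
  ∀ (T : H →L[ℂ] H) (hT : MemL1Inf T), 0 < T →
    ω (dilateTwo ⟨gammaSeq T, hT.2⟩) = ω ⟨gammaSeq T, hT.2⟩

/-- A positive `T ∈ L^{1,∞}` is measurable (in the sense of Connes) if the value
`Tr_ω(T) = ω(γ(T))` of the Dixmier trace is the same for all `ω ∈ DL₂`. -/
def IsMeasurableOp {H : Type*} [NormedAddCommGroup H] [InnerProductSpace ℂ H] [CompleteSpace H]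
    (T : H →L[ℂ] H) (hT : MemL1Inf T) : Prop :=
  ∃ c : ℂ, ∀ ω : EllInfty →L[ℂ] ℂ, IsDL2 H ω → ω ⟨gammaSeq T, hT.2⟩ = c

/-! ## The flat torus and its Laplacian -/

/-- Lebesgue measure on the flat torus `(ℝ/ℤ)^n`, of total mass one. -/
def torusMeasure (n : ℕ) : Measure (UnitAddTorus (Fin n)) :=
  Measure.pi fun _ => AddCircle.haarAddCircle

/-- The Hilbert space `L²(𝕋^n)`. -/
abbrev L2Torus (n : ℕ) : Type := Lp ℂ 2 (torusMeasure n)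

/-- The Hodge Laplacian `-∑_j ∂_j²` on functions on the flat torus. -/
def hodgeLaplacian {n : ℕ} (u : UnitAddTorus (Fin n) → ℂ) (x : UnitAddTorus (Fin n)) : ℂ :=
  -∑ j : Fin n, iteratedDeriv 2 (fun t : ℝ => u (x + Pi.single j (t : UnitAddCircle))) 0

/-- The orthonormal basis of `L²(𝕋^n)` formed by the exponentials
`h_m(x) = exp(2πi m·x)`, `m ∈ ℤ^n`. -/
def expBasis (n : ℕ) : HilbertBasis (Fin n → ℤ) ℂ (L2Torus n) :=
  UnitAddTorus.mFourierBasis (d := Fin n)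

/-- The eigenvalue `4π²|m|²` of the Hodge Laplacian at `h_m`. -/
def eigenvalue {n : ℕ} (m : Fin n → ℤ) : ℝ :=
  4 * Real.pi ^ 2 * ∑ j, (m j : ℝ) ^ 2

theorem coeFn_expBasis (n : ℕ) (m : Fin n → ℤ) :
    (expBasis n m : UnitAddTorus (Fin n) → ℂ) =ᵐ[torusMeasure n] UnitAddTorus.mFourier m := by
  have h : expBasis n m = UnitAddTorus.mFourierLp 2 m :=
    congrFun (UnitAddTorus.coe_mFourierBasis (d := Fin n)) m
  rw [h]
  exact UnitAddTorus.coeFn_mFourierLp 2 m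

/-- The exponentials are eigenfunctions of the Hodge Laplacian. -/
theorem hodgeLaplacian_mFourier {n : ℕ} (m : Fin n → ℤ) (x : UnitAddTorus (Fin n)) :
    hodgeLaplacian (UnitAddTorus.mFourier m) x =
      (eigenvalue m : ℂ) * UnitAddTorus.mFourier m x := by
  have key : ∀ (j : Fin n) (t : ℝ),
      UnitAddTorus.mFourier m (x + Pi.single j (t : UnitAddCircle)) =
        UnitAddTorus.mFourier m x * Complex.exp ((2 * Real.pi * Complex.I * m j) * t) := by
    intro j t
    have h1 : UnitAddTorus.mFourier m (x + Pi.single j (t : UnitAddCircle)) =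
        UnitAddTorus.mFourier m x *
          UnitAddTorus.mFourier m (Pi.single j (t : UnitAddCircle)) := by
      simp only [UnitAddTorus.mFourier, ContinuousMap.coe_mk, Pi.add_apply, fourier_apply,
        smul_add, AddCircle.toCircle_add, Circle.coe_mul, Finset.prod_mul_distrib]
    rw [h1]
    congr 1
    simp only [UnitAddTorus.mFourier, ContinuousMap.coe_mk]
    rw [Finset.prod_eq_single j]
    · rw [Pi.single_eq_same, fourier_coe_apply]
      simp only [Complex.ofReal_one, div_one]
    · intro i _ hi
      rw [Pi.single_eq_of_ne hi, fourier_eval_zero]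
    · simp
  have h2 : ∀ j : Fin n,
      iteratedDeriv 2
        (fun t : ℝ => UnitAddTorus.mFourier m (x + Pi.single j (t : UnitAddCircle))) 0 =
        -(4 * Real.pi ^ 2 * (m j : ℂ) ^ 2) * UnitAddTorus.mFourier m x := by
    intro j
    simp only [key]
    set c : ℂ := 2 * Real.pi * Complex.I * m j with hc
    have hd : ∀ (A : ℂ) (t : ℝ),
        HasDerivAt (fun t : ℝ => A * Complex.exp (c * t)) (A * c * Complex.exp (c * t)) t := by
      intro A t
      have h3 : HasDerivAt (fun t : ℝ => c * (t : ℂ)) c t := by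
        simpa using (Complex.ofRealCLM.hasDerivAt (x := t)).const_mul c
      have h4 := (h3.cexp).const_mul A
      rw [show A * c * Complex.exp (c * t) = A * (Complex.exp (c * t) * c) by ring]
      exact h4
    have hd' : ∀ A : ℂ, deriv (fun t : ℝ => A * Complex.exp (c * t)) =
        fun t : ℝ => A * c * Complex.exp (c * t) := fun A => funext fun t => (hd A t).deriv
    rw [iteratedDeriv_succ, iteratedDeriv_one, hd', hd']
    simp only [Complex.ofReal_zero, mul_zero, Complex.exp_zero, mul_one]
    rw [hc]
    linear_combination
      (4 * (Real.pi : ℂ) ^ 2 * (m j : ℂ) ^ 2 * UnitAddTorus.mFourier m x) * Complex.I_sq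
  rw [hodgeLaplacian]
  simp only [h2]
  rw [eigenvalue]
  push_cast
  rw [← Finset.sum_mul, Finset.sum_neg_distrib, ← Finset.mul_sum]
  ring

/-- Multiplication of a family in `ℓ²(ι)` by a bounded family. -/
def mulEllTwo {ι : Type*} (a : ι → ℂ) (h : ∃ C : ℝ, ∀ i, ‖a i‖ ≤ C) :
    lp (fun _ : ι => ℂ) 2 →L[ℂ] lp (fun _ : ι => ℂ) 2 :=
  have hle : ∀ (x : lp (fun _ : ι => ℂ) 2) (i : ι),
      ‖a i * x i‖ ≤ ‖((h.choose : ℂ) • x) i‖ := by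
    intro x i
    have h0 : 0 ≤ h.choose := (norm_nonneg _).trans (h.choose_spec i)
    rw [lp.coeFn_smul, Pi.smul_apply, norm_mul, norm_smul, Complex.norm_real,
      Real.norm_of_nonneg h0]
    exact mul_le_mul_of_nonneg_right (h.choose_spec i) (norm_nonneg _)
  have hmem : ∀ x : lp (fun _ : ι => ℂ) 2, Memℓp (fun i => a i * x i) 2 := fun x =>
    memℓp_gen (by
      refine Summable.of_nonneg_of_le (fun i => by positivity) (fun i => ?_)
        ((lp.memℓp ((h.choose : ℂ) • x)).summable (by norm_num))
      exact Real.rpow_le_rpow (norm_nonneg _) (hle x i) (by norm_num))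
  LinearMap.mkContinuous
    { toFun := fun x => ⟨fun i => a i * x i, hmem x⟩
      map_add' := fun x y => Subtype.ext (funext fun i => mul_add (a i) (x i) (y i))
      map_smul' := fun c x => Subtype.ext (funext fun i => mul_left_comm (a i) c (x i)) }
    ‖(h.choose : ℂ)‖ (fun x => by
      rw [← norm_smul]
      refine lp.norm_le_of_tsum_le (by norm_num) (norm_nonneg _) ?_
      rw [lp.norm_rpow_eq_tsum (by norm_num)]
      refine Summable.tsum_le_tsum (fun i => ?_) ((hmem x).summable (by norm_num))
        ((lp.memℓp ((h.choose : ℂ) • x)).summable (by norm_num))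
      exact Real.rpow_le_rpow (norm_nonneg _) (hle x i) (by norm_num))

open Classical in
/-- The operator which is diagonal in the orthonormal basis `b`, with `b i ↦ a i • b i`, for a
bounded family `a` (it is set to `0` if `a` is not bounded). -/
def diagonalOp {H ι : Type*} [NormedAddCommGroup H] [InnerProductSpace ℂ H] [CompleteSpace H]
    (b : HilbertBasis ι ℂ H) (a : ι → ℂ) : H →L[ℂ] H :=
  if h : ∃ C : ℝ, ∀ i, ‖a i‖ ≤ C then
    (b.repr.symm.toContinuousLinearEquiv : lp (fun _ : ι => ℂ) 2 →L[ℂ] H) ∘L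
      mulEllTwo a h ∘L
      (b.repr.toContinuousLinearEquiv : H →L[ℂ] lp (fun _ : ι => ℂ) 2)
  else 0

theorem diagonalOp_apply_basis {H ι : Type*} [NormedAddCommGroup H] [InnerProductSpace ℂ H]
    [CompleteSpace H] (b : HilbertBasis ι ℂ H) (a : ι → ℂ) (C : ℝ) (hC : ∀ i, ‖a i‖ ≤ C)
    (i : ι) : diagonalOp b a (b i) = a i • b i := by
  classical
  have h : ∃ C : ℝ, ∀ i, ‖a i‖ ≤ C := ⟨C, hC⟩
  rw [diagonalOp, dif_pos h]
  apply b.repr.injective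
  ext j
  simp only [ContinuousLinearMap.coe_comp, Function.comp_apply, map_smul]
  simp only [mulEllTwo]
  by_cases hij : j = i
  · subst hij
    simp
  · have h0 : b.repr (b i) j = 0 := by
      rw [b.repr_self, lp.single_apply_ne _ _ _ hij]
    simp [h0]

/-- The function `g(Δ)` of the Hodge Laplacian, for a bounded function `g`: the bounded operator
on `L²(𝕋^n)` with `g(Δ) h_m = g(λ_m) h_m`, where `λ_m` is the eigenvalue of `Δ` at `h_m`. -/
def funLaplacian (n : ℕ) (g : ℝ → ℝ) : L2Torus n →L[ℂ] L2Torus n :=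
  diagonalOp (expBasis n) fun m => (g (eigenvalue m) : ℂ)

theorem funLaplacian_expBasis (n : ℕ) (g : ℝ → ℝ) (C : ℝ) (hC : ∀ x, |g x| ≤ C)
    (m : Fin n → ℤ) :
    funLaplacian n g (expBasis n m) = (g (eigenvalue m) : ℂ) • expBasis n m :=
  diagonalOp_apply_basis (expBasis n) _ C
    (fun i => by rw [Complex.norm_real]; exact hC _) m

/-! ## The symmetrised product `√A M_f √A` -/

/-- The bounded operator `S` is the symmetrised product `R M_f R` of a bounded operator `R` with
the (in general unbounded) operator `M_f` of multiplication by `f`, in the sense of quadratic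
forms: `⟨u, S v⟩ = ⟨R u, M_f R v⟩ = ∫ conj (R u) f (R v)` for all `u, v ∈ L²(𝕋^n)`, where the
integrals converge absolutely.

For `R = √A ≥ 0` and `f ≥ 0` this says that the closed operator `√M_f √A` is bounded, and that
`S = |√M_f √A|² = (√M_f √A)* (√M_f √A)`. -/
def IsSymmProd {n : ℕ} (R : L2Torus n →L[ℂ] L2Torus n) (f : UnitAddTorus (Fin n) → ℂ)
    (S : L2Torus n →L[ℂ] L2Torus n) : Prop :=
  ∀ u v : L2Torus n,
    Integrable (fun x => conj (R u x) * f x * R v x) (torusMeasure n) ∧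
    ⟪u, S v⟫_ℂ = ∫ x, conj (R u x) * f x * R v x ∂torusMeasure n

theorem IsSymmProd.unique {n : ℕ} {R : L2Torus n →L[ℂ] L2Torus n}
    {f : UnitAddTorus (Fin n) → ℂ} {S S' : L2Torus n →L[ℂ] L2Torus n}
    (h : IsSymmProd R f S) (h' : IsSymmProd R f S') : S = S' := by
  ext1 v
  refine ext_inner_left ℂ fun u => ?_
  rw [(h u v).2, (h' u v).2]

/-- `R M_f R` is (densely defined and) bounded. -/
def SymmBounded {n : ℕ} (R : L2Torus n →L[ℂ] L2Torus n) (f : UnitAddTorus (Fin n) → ℂ) : Prop :=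
  ∃ S, IsSymmProd R f S

open Classical in
/-- The bounded operator `R M_f R` (set to `0` if `R M_f R` is not bounded). -/
def symmProd {n : ℕ} (R : L2Torus n →L[ℂ] L2Torus n) (f : UnitAddTorus (Fin n) → ℂ) :
    L2Torus n →L[ℂ] L2Torus n :=
  if h : SymmBounded R f then h.choose else 0

/-- `G(Δ)^s`, that is `(G^s)(Δ)`. -/
def powLaplacian (n : ℕ) (G : ℝ → ℝ) (s : ℝ) : L2Torus n →L[ℂ] L2Torus n :=
  funLaplacian n fun x => G x ^ s

/-- `G(Δ)^{s/2} M_f G(Δ)^{s/2}` is bounded and trace class. -/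
def SymmTraceClass (n : ℕ) (G : ℝ → ℝ) (s : ℝ) (f : UnitAddTorus (Fin n) → ℂ) : Prop :=
  SymmBounded (powLaplacian n G (s / 2)) f ∧
    IsTraceClass (symmProd (powLaplacian n G (s / 2)) f)

/-- The sequence `(1/k) Tr (G(Δ)^{1+1/k})`, `k ≥ 1`; the index `i` of the code is `k - 1`. -/
def zetaSeq (n : ℕ) (G : ℝ → ℝ) (i : ℕ) : ℂ :=
  let k : ℝ := (i + 1 : ℕ)
  (1 / k : ℝ) * trace (expBasis n) (powLaplacian n G (1 + 1 / k))

/-- The sequence `(1/k) Tr (G(Δ)^{(1+1/k)/2} M_f G(Δ)^{(1+1/k)/2})`, `k ≥ 1`; the index `i` of the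
code is `k - 1`. -/
def symmZetaSeq (n : ℕ) (G : ℝ → ℝ) (f : UnitAddTorus (Fin n) → ℂ) (i : ℕ) : ℂ :=
  let k : ℝ := (i + 1 : ℕ)
  (1 / k : ℝ) * trace (expBasis n) (symmProd (powLaplacian n G ((1 + 1 / k) / 2)) f)

end TorusResidue

end

open TorusResidue

/-! The exponentials have modulus one. With R = G(Δ)^{s/2} the diagonal entry of R M_f R at h_m is
therefore G(λ_m)^s ∫ f, and the trace factorises as Tr G(Δ)^s · ∫ f. What remains is to see that R
M_f R is trace class, and to find the limit of (1/k) Tr G(Δ)^{1+1/k}.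

Trace class: for s > 1 the eigenvalues of R are square summable, so by Cauchy–Schwarz the Fourier
series of R u converges uniformly and R maps L² to L^∞ (`ae_norm_diagonalOp_le`). The form of R M_f
R is thus bounded for integrable f (`exists_isSymmProd`). If f ≥ 0, the operator is positive with
summable diagonal, hence trace class (`isTraceClass_of_nonneg`); a general f is a combination of
four nonnegative functions. Conversely, testing the form at a single h_m with G(λ_m) > 0 shows that
f is integrable (`integrable_of_symmBounded`).

The limit has a Tauberian and an Abelian half. Tauberian: ultrafilter limits of the means of a(2^e)
over long windows of exponents e belong to `IsDL2`, so measurability makes all these means of γ(T)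
converge to one value. The partial sums of singular values increase, and log 2^e changes only by a
factor 1 + o(1) along a window of length √p at p; this squeezes γ(T) itself
(`tendsto_dyadic_of_means`, `IsMeasurableOp.exists_tendsto`). Abelian: the power sum of exponent 1 +
1/k is a Laplace-type integral of the sum of the μ_j above a threshold, and dominated convergence
gives the limit (`tendsto_zeta_of_tendsto_gamma`). `tsum_singVal_rpow` passes between singular
values and the numbers G(λ_m). -/

namespace TorusResidue

/-! ### Approximation numbers and trace class operators -/

section SingularValues

variable {H : Type*} [NormedAddCommGroup H] [InnerProductSpace ℂ H]

theorem singVal_le_norm_sub (T F : H →L[ℂ] H) {k : ℕ}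
    (hF : (F : H →ₗ[ℂ] H).rank ≤ (k : Cardinal)) : singVal T k ≤ ‖T - F‖ :=
  csInf_le ⟨0, by rintro _ ⟨F, -, rfl⟩; exact norm_nonneg _⟩ ⟨F, hF, rfl⟩

theorem singVal_image_nonempty (T : H →L[ℂ] H) (k : ℕ) :
    ((fun F : H →L[ℂ] H => ‖T - F‖) ''
      {F | (F : H →ₗ[ℂ] H).rank ≤ (k : Cardinal)}).Nonempty :=
  ⟨_, 0, by simp [LinearMap.rank_zero], rfl⟩

theorem le_singVal {T : H →L[ℂ] H} {k : ℕ} {r : ℝ}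
    (h : ∀ F : H →L[ℂ] H, (F : H →ₗ[ℂ] H).rank ≤ (k : Cardinal) → r ≤ ‖T - F‖) :
    r ≤ singVal T k :=
  le_csInf (singVal_image_nonempty T k) (by rintro _ ⟨F, hF, rfl⟩; exact h F hF)

theorem singVal_nonneg (T : H →L[ℂ] H) (k : ℕ) : 0 ≤ singVal T k :=
  le_singVal fun _ _ => norm_nonneg _

theorem singVal_antitone (T : H →L[ℂ] H) : Antitone (singVal T) := fun _ _ h =>
  le_singVal fun F hF => singVal_le_norm_sub T F (hF.trans (by exact_mod_cast h))

theorem exists_norm_sub_lt (T : H →L[ℂ] H) (k : ℕ) {ε : ℝ} (hε : 0 < ε) :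
    ∃ F : H →L[ℂ] H, (F : H →ₗ[ℂ] H).rank ≤ (k : Cardinal) ∧ ‖T - F‖ < singVal T k + ε := by
  obtain ⟨_, ⟨F, hF, rfl⟩, h⟩ :=
    exists_lt_of_csInf_lt (singVal_image_nonempty T k) (lt_add_of_pos_right (singVal T k) hε)
  exact ⟨F, hF, h⟩

theorem rank_add_le_natCast {F G : H →L[ℂ] H} {j k : ℕ}
    (hF : (F : H →ₗ[ℂ] H).rank ≤ (j : Cardinal)) (hG : (G : H →ₗ[ℂ] H).rank ≤ (k : Cardinal)) :
    ((F + G : H →L[ℂ] H) : H →ₗ[ℂ] H).rank ≤ ((j + k : ℕ) : Cardinal) := by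
  have h := LinearMap.rank_add_le (F : H →ₗ[ℂ] H) (G : H →ₗ[ℂ] H)
  rw [Nat.cast_add]
  exact h.trans (add_le_add hF hG)

theorem singVal_add_le (S T : H →L[ℂ] H) (j k : ℕ) :
    singVal (S + T) (j + k) ≤ singVal S j + singVal T k := by
  refine le_of_forall_pos_le_add fun ε hε => ?_
  obtain ⟨F, hF, hF'⟩ := exists_norm_sub_lt S j (half_pos hε)
  obtain ⟨G, hG, hG'⟩ := exists_norm_sub_lt T k (half_pos hε)
  have h := singVal_le_norm_sub (S + T) (F + G) (rank_add_le_natCast hF hG)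
  have h2 : ‖S + T - (F + G)‖ ≤ ‖S - F‖ + ‖T - G‖ := by
    rw [add_sub_add_comm]; exact norm_add_le _ _
  linarith

theorem singVal_smul_le (c : ℂ) (T : H →L[ℂ] H) (k : ℕ) :
    singVal (c • T) k ≤ ‖c‖ * singVal T k := by
  refine le_of_forall_pos_le_add fun ε hε => ?_
  -- The `+ 1` keeps the denominator positive when `c = 0`.
  obtain ⟨F, hF, hF'⟩ := exists_norm_sub_lt T k (ε := ε / (‖c‖ + 1)) (by positivity)
  have hr : ((c • F : H →L[ℂ] H) : H →ₗ[ℂ] H).rank ≤ (k : Cardinal) := by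
    refine le_trans ?_ hF
    refine Submodule.rank_mono ?_
    rintro _ ⟨x, rfl⟩
    exact ⟨c • x, by simp⟩
  have h := singVal_le_norm_sub (c • T) (c • F) hr
  rw [← smul_sub, norm_smul] at h
  have h3 : ‖c‖ * (ε / (‖c‖ + 1)) ≤ ε := by
    rw [mul_div_assoc', div_le_iff₀ (by positivity)]
    nlinarith [norm_nonneg c]
  nlinarith [norm_nonneg c]

/-- The bounds for sums and for compressions cost a factor two in the rank, so they control only the
even indices; monotonicity supplies the odd ones. -/
theorem summable_singVal_of_even {T : H →L[ℂ] H} (h : Summable fun k => singVal T (2 * k)) :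
    Summable (singVal T) := by
  have h2 : Summable fun k => singVal T (2 * k + 1) :=
    h.of_nonneg_of_le (fun _ => singVal_nonneg _ _) fun k => singVal_antitone T (Nat.le_succ _)
  exact (h.hasSum.even_add_odd h2.hasSum).summable

/-- The operator subtracted from S to leave the compression (1 - P) S (1 - P). Regrouped as P S + (S
- P S) P, it is a sum of two terms, each with a factor P. -/
theorem rank_sub_compression_le (S P : H →L[ℂ] H) {k : ℕ}
    (hP : (P : H →ₗ[ℂ] H).rank ≤ (k : Cardinal)) :
    ((P ∘L S + S ∘L P - P ∘L S ∘L P : H →L[ℂ] H) : H →ₗ[ℂ] H).rank ≤ ((2 * k : ℕ) : Cardinal) := by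
  have h1 : P ∘L S + S ∘L P - P ∘L S ∘L P = P ∘L S + (S - P ∘L S) ∘L P := by
    ext x; simp; abel
  rw [h1, two_mul]
  refine rank_add_le_natCast ?_ ?_
  · exact (LinearMap.rank_comp_le_left (S : H →ₗ[ℂ] H) (P : H →ₗ[ℂ] H)).trans hP
  · exact (LinearMap.rank_comp_le_right (P : H →ₗ[ℂ] H) ((S - P ∘L S : H →L[ℂ] H) : H →ₗ[ℂ] H)).trans hP

theorem hasSum_norm_inner_sq {ι : Type*} (b : HilbertBasis ι ℂ H) (x : H) :
    HasSum (fun i => ‖⟪b i, x⟫_ℂ‖ ^ 2) (‖x‖ ^ 2) := by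
  have h' := Complex.reCLM.hasSum (b.hasSum_inner_mul_inner x x)
  convert h' using 1
  · ext i
    rw [← inner_conj_symm x (b i), mul_comm, Complex.mul_conj,
      Complex.normSq_eq_norm_sq]
    simp
    norm_cast
  · rw [inner_self_eq_norm_sq_to_K]
    simp
    norm_cast

theorem isCompactOperator_of_rank_le {F : H →L[ℂ] H} {k : ℕ}
    (hF : (F : H →ₗ[ℂ] H).rank ≤ (k : Cardinal)) : IsCompactOperator F := by
  have hfin : FiniteDimensional ℂ (LinearMap.range (F : H →ₗ[ℂ] H)) :=
    Module.rank_lt_aleph0_iff.1 (lt_of_le_of_lt hF (Cardinal.natCast_lt_aleph0))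
  have : ProperSpace (LinearMap.range (F : H →ₗ[ℂ] H)) := FiniteDimensional.proper ℂ _
  let F' : H →L[ℂ] LinearMap.range (F : H →ₗ[ℂ] H) :=
    F.codRestrict _ fun x => LinearMap.mem_range_self (F : H →ₗ[ℂ] H) x
  have h1 : IsCompactOperator F' := isCompactOperator_of_locallyCompactSpace_dom F'
  exact h1.clm_comp (Submodule.subtypeL _)

variable [CompleteSpace H]

theorem isCompactOperator_of_tendsto_singVal {T : H →L[ℂ] H}
    (h : Tendsto (singVal T) atTop (𝓝 0)) : IsCompactOperator T := by
  -- The infimum defining `singVal` need not be attained, hence the extra error 1/(k+1).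
  choose F hF hF' using fun k : ℕ => exists_norm_sub_lt T k (ε := 1 / ((k : ℝ) + 1)) (by positivity)
  refine isCompactOperator_of_tendsto (l := atTop) (F := F) ?_
    (Eventually.of_forall fun k => isCompactOperator_of_rank_le (hF k))
  rw [tendsto_iff_norm_sub_tendsto_zero]
  have h0 : Tendsto (fun k : ℕ => singVal T k + 1 / ((k : ℝ) + 1)) atTop (𝓝 0) := by
    simpa using h.add tendsto_one_div_add_atTop_nhds_zero_nat
  exact squeeze_zero (fun _ => norm_nonneg _)
    (fun k => by rw [norm_sub_rev]; exact (hF' k).le) h0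

theorem isTraceClass_of_summable {T : H →L[ℂ] H} (h : Summable (singVal T)) : IsTraceClass T :=
  ⟨isCompactOperator_of_tendsto_singVal h.tendsto_atTop_zero, h⟩

theorem IsTraceClass.add {S T : H →L[ℂ] H} (hS : IsTraceClass S) (hT : IsTraceClass T) :
    IsTraceClass (S + T) :=
  isTraceClass_of_summable <| summable_singVal_of_even <|
    (hS.2.add hT.2).of_nonneg_of_le (fun _ => singVal_nonneg _ _) fun k => by
      rw [two_mul]; exact singVal_add_le S T k k

theorem IsTraceClass.smul {T : H →L[ℂ] H} (hT : IsTraceClass T) (c : ℂ) :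
    IsTraceClass (c • T) :=
  isTraceClass_of_summable <|
    (hT.2.mul_left ‖c‖).of_nonneg_of_le (fun _ => singVal_nonneg _ _) (singVal_smul_le c T)

/-! ### Positive operators with summable diagonal -/

/-- Expand each B u_j in the basis b by Parseval, move B across the inner product, exchange the
sums, and apply Bessel to each B b_i. Only orthonormality of u is needed. -/
theorem sum_norm_sq_le_of_orthonormal {ι κ : Type*} (b : HilbertBasis ι ℂ H) {B : H →L[ℂ] H}
    (hB : IsSelfAdjoint B) (hs : Summable fun i => ‖B (b i)‖ ^ 2) {u : κ → H}
    (hu : Orthonormal ℂ u) (s : Finset κ) :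
    ∑ j ∈ s, ‖B (u j)‖ ^ 2 ≤ ∑' i, ‖B (b i)‖ ^ 2 := by
  have hsymm : ∀ x y : H, ⟪B x, y⟫_ℂ = ⟪x, B y⟫_ℂ := fun x y => by
    rw [← ContinuousLinearMap.adjoint_inner_right, ← ContinuousLinearMap.star_eq_adjoint,
      hB.star_eq]
  have h1 : ∀ j, HasSum (fun i => ‖⟪u j, B (b i)⟫_ℂ‖ ^ 2) (‖B (u j)‖ ^ 2) := fun j => by
    convert hasSum_norm_inner_sq b (B (u j)) using 3 with i
    rw [← hsymm, norm_inner_symm]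
  have h2 := hasSum_sum (s := s) fun j _ => h1 j
  rw [← h2.tsum_eq]
  exact h2.summable.tsum_le_tsum (fun i => hu.sum_inner_products_le _) hs

/-- Let P project onto the span of s and Q = 1 - P. Then Q B² Q = (BQ)*(BQ) differs from B² by rank
at most 2|s|, so the singular value is at most ‖BQ‖², and a vector nearly attaining ‖BQ‖ can be
taken in the range of Q. -/
theorem exists_unit_orthogonal {B : H →L[ℂ] H} (hB : IsSelfAdjoint B) (s : Finset H)
    (hpos : 0 < singVal (B * B) (2 * s.card)) :
    ∃ u : H, ‖u‖ = 1 ∧ (∀ v ∈ s, ⟪v, u⟫_ℂ = 0) ∧ singVal (B * B) (2 * s.card) ≤ 2 * ‖B u‖ ^ 2 := by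
  set V : Submodule ℂ H := Submodule.span ℂ (s : Set H) with hV
  have hfin : FiniteDimensional ℂ V := FiniteDimensional.span_finset ℂ s
  set P : H →L[ℂ] H := V.starProjection with hP
  set Q : H →L[ℂ] H := 1 - P with hQ
  have hPsa : IsSelfAdjoint P := isSelfAdjoint_starProjection V
  have hQsa : IsSelfAdjoint Q := (IsSelfAdjoint.one _).sub hPsa
  have hrank : (P : H →ₗ[ℂ] H).rank ≤ (s.card : Cardinal) := by
    refine le_trans (Submodule.rank_mono ?_) (rank_span_finset_le (R := ℂ) s)
    rintro _ ⟨x, rfl⟩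
    exact Submodule.starProjection_apply_mem V x
  have h1 := singVal_le_norm_sub (B * B) _ (rank_sub_compression_le (B * B) P hrank)
  have h2 : B * B - (P ∘L (B * B) + (B * B) ∘L P - P ∘L (B * B) ∘L P) = star (B * Q) * (B * Q) := by
    rw [star_mul, hB.star_eq, hQsa.star_eq, hQ]
    change B * B - (P * (B * B) + (B * B) * P - P * ((B * B) * P)) = _
    noncomm_ring
  rw [h2, CStarRing.norm_star_mul_self] at h1
  set r := ‖B * Q‖ with hr
  have hr0 : 0 < r := by
    by_contra h
    have : r = 0 := le_antisymm (not_lt.1 h) (norm_nonneg _)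
    rw [this] at h1; simp at h1; linarith
  -- Any fraction whose square is at least 1/2 gives the factor 2 in the conclusion; here (3/4)² =
  -- 9/16.
  have h3 : r * (3 / 4) < ‖B * Q‖ := by linarith
  obtain ⟨x, hx1, hx⟩ := (B * Q).exists_lt_apply_of_lt_opNorm h3
  set y := Q x with hy
  have hy' : ‖y‖ ≤ 1 := by
    have : ‖y‖ ≤ ‖x‖ := by
      have : y = Vᗮ.starProjection x := by
        rw [Submodule.starProjection_orthogonal]; rfl
      rw [this]
      exact Submodule.norm_starProjection_apply_le _ _
    linarith
  have hBy : r * (3 / 4) < ‖B y‖ := hx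
  have hy0 : y ≠ 0 := by
    intro h; rw [h] at hBy; simp at hBy; linarith
  have hyn : 0 < ‖y‖ := norm_pos_iff.2 hy0
  refine ⟨((‖y‖⁻¹ : ℝ) : ℂ) • y, ?_, ?_, ?_⟩
  · rw [norm_smul, Complex.norm_real, norm_inv, norm_norm, inv_mul_cancel₀ hyn.ne']
  · intro v hv
    rw [inner_smul_right]
    have : ⟪v, y⟫_ℂ = 0 := by
      have hv' : v ∈ V := Submodule.subset_span hv
      exact (V.mem_orthogonal y).1 (Submodule.sub_starProjection_mem_orthogonal x) v hv'
    rw [this, mul_zero]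
  · rw [map_smul, norm_smul, Complex.norm_real, norm_inv, norm_norm, mul_pow]
    have h4 : (1 : ℝ) ≤ ‖y‖⁻¹ ^ 2 := one_le_pow₀ ((one_le_inv₀ hyn).2 hy')
    have h5 : (r * (3 / 4)) ^ 2 ≤ ‖B y‖ ^ 2 := by gcongr
    nlinarith [sq_nonneg ‖B y‖]

/-- Greedy construction: each new vector is orthogonal to the previous ones and captures one more
even-indexed singular value. This avoids the spectral theorem for compact operators. -/
theorem exists_finset_orthonormal {B : H →L[ℂ] H} (hB : IsSelfAdjoint B) (k : ℕ)
    (hpos : ∀ j < k, 0 < singVal (B * B) (2 * j)) :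
    ∃ s : Finset H, s.card = k ∧ (∀ u ∈ s, ‖u‖ = 1) ∧
      (∀ u ∈ s, ∀ v ∈ s, u ≠ v → ⟪u, v⟫_ℂ = 0) ∧
      ∑ j ∈ Finset.range k, singVal (B * B) (2 * j) ≤ 2 * ∑ u ∈ s, ‖B u‖ ^ 2 := by
  classical
  induction k with
  | zero => exact ⟨∅, by simp⟩
  | succ k ih =>
    obtain ⟨s, hcard, hnorm, horth, hsum⟩ := ih fun j hj => hpos j (by omega)
    obtain ⟨u, hu1, hu2, hu3⟩ := exists_unit_orthogonal hB s (by rw [hcard]; exact hpos k (by omega))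
    have hus : u ∉ s := fun h => by
      have h0 := hu2 u h
      rw [inner_self_eq_zero] at h0
      rw [h0] at hu1; simp at hu1
    refine ⟨insert u s, by rw [Finset.card_insert_of_notMem hus, hcard], ?_, ?_, ?_⟩
    · intro v hv
      rcases Finset.mem_insert.1 hv with rfl | hv
      · exact hu1
      · exact hnorm v hv
    · intro v hv w hw hvw
      rcases Finset.mem_insert.1 hv with hv | hv <;> rcases Finset.mem_insert.1 hw with hw | hw
      · exact absurd (hv.trans hw.symm) hvw
      · rw [hv]; exact inner_eq_zero_symm.1 (hu2 w hw)
      · rw [hw]; exact hu2 v hv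
      · exact horth v hv w hw hvw
    · rw [Finset.sum_range_succ, Finset.sum_insert hus]
      rw [hcard] at hu3
      linarith

/-- A positive operator with summable diagonal in some orthonormal basis is trace class. -/
theorem isTraceClass_of_nonneg {ι : Type*} (b : HilbertBasis ι ℂ H) {S : H →L[ℂ] H}
    (hS : 0 ≤ S) (hs : Summable fun i => ⟪b i, S (b i)⟫_ℂ) : IsTraceClass S := by
  obtain ⟨B, hB, hBS⟩ : ∃ B : H →L[ℂ] H, IsSelfAdjoint B ∧ B * B = S :=
    ⟨CFC.sqrt S, (CFC.sqrt_nonneg S).isSelfAdjoint, CFC.sqrt_mul_sqrt_self S hS⟩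
  have hdiag : ∀ x, ‖B x‖ ^ 2 = (⟪x, S x⟫_ℂ).re := fun x => by
    rw [← hBS, mul_apply_eq_comp, ← ContinuousLinearMap.adjoint_inner_left,
      ← ContinuousLinearMap.star_eq_adjoint, hB.star_eq, inner_self_eq_norm_sq_to_K]
    simp
    norm_cast
  have hsum : Summable fun i => ‖B (b i)‖ ^ 2 := by
    simp_rw [hdiag]
    exact Complex.reCLM.summable hs
  subst hBS
  refine isTraceClass_of_summable <| summable_singVal_of_even ?_
  by_cases hpos : ∀ j, 0 < singVal (B * B) (2 * j)
  · refine summable_of_sum_range_le (c := 2 * ∑' i, ‖B (b i)‖ ^ 2)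
      (fun _ => singVal_nonneg _ _) fun k => ?_
    obtain ⟨s, -, hnorm, horth, hle⟩ := exists_finset_orthonormal hB k fun j _ => hpos j
    refine hle.trans ?_
    have ho : Orthonormal ℂ (Subtype.val : s → H) :=
      ⟨fun u => hnorm u u.2, fun u v huv =>
        horth u u.2 v v.2 fun h => huv (Subtype.ext h)⟩
    have := sum_norm_sq_le_of_orthonormal b hB hsum ho Finset.univ
    rw [Finset.univ_eq_attach, Finset.sum_attach s fun u => ‖B u‖ ^ 2] at this
    linarith
  -- Once a singular value vanishes so do all later ones, and the sum is finite.
  · push Not at hpos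
    obtain ⟨j, hj⟩ := hpos
    refine summable_of_ne_finset_zero (s := Finset.range j) fun i hi => ?_
    refine le_antisymm (le_trans (singVal_antitone _ ?_) hj) (singVal_nonneg _ _)
    have := Finset.mem_range.not.1 hi
    omega

end SingularValues

/-! ### Singular values of diagonal operators -/

section Diagonal

variable {H ι : Type*} [NormedAddCommGroup H] [InnerProductSpace ℂ H]
  (b : HilbertBasis ι ℂ H)

theorem ext_inner_basis {x y : H} (h : ∀ i, ⟪b i, x⟫_ℂ = ⟪b i, y⟫_ℂ) : x = y := by
  apply b.repr.injective
  ext i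
  rw [b.repr_apply_apply, b.repr_apply_apply, h]

theorem norm_sq_sum_smul (F : Finset ι) (c : F → ℂ) :
    ‖∑ i, c i • b (i : ι)‖ ^ 2 = ∑ i, ‖c i‖ ^ 2 := by
  have h := (b.orthonormal.comp (Subtype.val : F → ι) Subtype.val_injective).inner_sum c c
    Finset.univ
  simp only [Function.comp_apply] at h
  simp_rw [Complex.conj_mul'] at h
  rw [@norm_sq_eq_re_inner ℂ, h]
  simp [← Complex.ofReal_pow, ← Complex.ofReal_sum]

variable [CompleteSpace H]

theorem inner_diagonalOp {a : ι → ℂ} {C : ℝ} (hC : ∀ i, ‖a i‖ ≤ C) (x : H) (i : ι) :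
    ⟪b i, diagonalOp b a x⟫_ℂ = a i * ⟪b i, x⟫_ℂ := by
  classical
  have h : ∃ C : ℝ, ∀ i, ‖a i‖ ≤ C := ⟨C, hC⟩
  rw [← b.repr_apply_apply, ← b.repr_apply_apply, diagonalOp, dif_pos h]
  simp [mulEllTwo]

theorem norm_diagonalOp_le {a : ι → ℂ} {C : ℝ} (h0 : 0 ≤ C) (hC : ∀ i, ‖a i‖ ≤ C) :
    ‖diagonalOp b a‖ ≤ C := by
  refine ContinuousLinearMap.opNorm_le_bound _ h0 fun x => ?_
  refine le_of_sq_le_sq ?_ (by positivity)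
  rw [mul_pow]
  refine hasSum_le (fun i => ?_) (hasSum_norm_inner_sq b (diagonalOp b a x))
    ((hasSum_norm_inner_sq b x).mul_left (C ^ 2))
  rw [inner_diagonalOp b hC, norm_mul, mul_pow]
  gcongr
  exact hC i

theorem diagonalOp_nonneg {a : ι → ℝ} {C : ℝ} (hC : ∀ i, a i ≤ C) (ha : ∀ i, 0 ≤ a i) :
    0 ≤ diagonalOp b (fun i => (a i : ℂ)) := by
  have hC' : ∀ i, ‖(a i : ℂ)‖ ≤ C := fun i => by
    rw [Complex.norm_real, Real.norm_of_nonneg (ha i)]; exact hC i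
  rw [ContinuousLinearMap.nonneg_iff_isPositive, ContinuousLinearMap.isPositive_iff_complex]
  intro x
  have h : HasSum (fun i => ((a i * ‖⟪b i, x⟫_ℂ‖ ^ 2 : ℝ) : ℂ))
      ⟪diagonalOp b (fun i => (a i : ℂ)) x, x⟫_ℂ := by
    have h1 : ∀ i, ((a i * ‖⟪b i, x⟫_ℂ‖ ^ 2 : ℝ) : ℂ) =
        ⟪diagonalOp b (fun i => (a i : ℂ)) x, b i⟫_ℂ * ⟪b i, x⟫_ℂ := fun i => by
      rw [← inner_conj_symm _ (b i), inner_diagonalOp b hC', map_mul, Complex.conj_ofReal,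
        mul_assoc, Complex.conj_mul']
      push_cast
      rfl
    simp_rw [h1]
    exact b.hasSum_inner_mul_inner _ x
  obtain ⟨r, hr⟩ : ∃ r : ℝ, HasSum (fun i => a i * ‖⟪b i, x⟫_ℂ‖ ^ 2) r := by
    have := Complex.reCLM.hasSum h
    exact ⟨_, by simpa only [Function.comp_def, Complex.reCLM_apply, Complex.ofReal_re] using this⟩
  rw [h.unique (Complex.hasSum_ofReal.2 hr)]
  exact ⟨by simp, by simpa using hr.nonneg fun i => mul_nonneg (ha i) (sq_nonneg _)⟩

theorem le_singVal_diagonalOp {a : ι → ℂ} {C : ℝ} (hC : ∀ i, ‖a i‖ ≤ C) {r : ℝ} (hr : 0 ≤ r)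
    {F : Finset ι} (hF : ∀ i ∈ F, r ≤ ‖a i‖) {k : ℕ} (hk : k < F.card) :
    r ≤ singVal (diagonalOp b a) k := by
  refine le_singVal fun K hK => ?_
  let l : (F → ℂ) →ₗ[ℂ] H := Fintype.linearCombination ℂ fun i : F => b i
  have hl : ∀ c, l c = ∑ i, c i • b (i : ι) := fun c => Fintype.linearCombination_apply _ _ _
  -- Dimension count: `K` has rank at most `k`, less than the number of basis vectors in `F`, so it
  -- kills a nonzero vector of their span.
  have hninj : ¬ Function.Injective ((K : H →ₗ[ℂ] H) ∘ₗ l) := by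
    intro hinj
    have h1 := LinearMap.finrank_range_of_inj hinj
    have h2 := Module.finrank_le_of_rank_le
      ((LinearMap.rank_comp_le_left l (K : H →ₗ[ℂ] H)).trans hK)
    rw [h1, Module.finrank_fintype_fun_eq_card, Fintype.card_coe] at h2
    omega
  obtain ⟨c, hc, hc0⟩ : ∃ c, K (l c) = 0 ∧ c ≠ 0 := by
    by_contra! h
    exact hninj ((injective_iff_map_eq_zero _).2 h)
  have hx : l c ≠ 0 := fun h0 => by
    have h1 := norm_sq_sum_smul b F c
    rw [← hl, h0] at h1
    simp only [norm_zero, ne_eq, OfNat.ofNat_ne_zero, not_false_eq_true, zero_pow] at h1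
    refine hc0 (funext fun i => ?_)
    have := (Finset.sum_eq_zero_iff_of_nonneg fun i _ => sq_nonneg ‖c i‖).1 h1.symm i (Finset.mem_univ i)
    simpa using this
  have h2 : r * ‖l c‖ ≤ ‖diagonalOp b a (l c)‖ := by
    refine le_of_sq_le_sq ?_ (norm_nonneg _)
    have h3 : diagonalOp b a (l c) = ∑ i : F, (c i * a i) • b (i : ι) := by
      rw [hl, map_sum]
      refine Finset.sum_congr rfl fun i _ => ?_
      rw [map_smul, diagonalOp_apply_basis b a C hC, smul_smul]
    rw [h3, norm_sq_sum_smul b F fun i => c i * a i, hl, mul_pow, norm_sq_sum_smul, Finset.mul_sum]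
    refine Finset.sum_le_sum fun i _ => ?_
    rw [norm_mul, mul_pow, mul_comm]
    gcongr
    exact hF i i.2
  have h4 : ‖diagonalOp b a (l c)‖ ≤ ‖diagonalOp b a - K‖ * ‖l c‖ := by
    have := (diagonalOp b a - K).le_opNorm (l c)
    rwa [_root_.sub_apply, hc, sub_zero] at this
  exact le_of_mul_le_mul_right (h2.trans h4) (norm_pos_iff.2 hx)

theorem singVal_diagonalOp_le {a : ι → ℂ} {C : ℝ} (hC : ∀ i, ‖a i‖ ≤ C) {r : ℝ} (hr : 0 ≤ r)
    {F : Finset ι} (hF : ∀ i ∉ F, ‖a i‖ ≤ r) {k : ℕ} (hk : F.card ≤ k) :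
    singVal (diagonalOp b a) k ≤ r := by
  classical
  -- Without an index nothing forces `0 ≤ C`, so the empty case is separate.
  rcases isEmpty_or_nonempty ι with hι | ⟨⟨i₀⟩⟩
  · have h1 := singVal_le_norm_sub (k := k) (diagonalOp b a) 0 (by simp [LinearMap.rank_zero])
    rw [sub_zero] at h1
    exact h1.trans (norm_diagonalOp_le b hr fun i => isEmptyElim i)
  have hC0 : 0 ≤ C := (norm_nonneg _).trans (hC i₀)
  -- The truncation to `F` is the competitor of rank at most `k`; the remainder has entries bounded
  -- by `r`.
  set a' : ι → ℂ := fun i => if i ∈ F then a i else 0 with ha'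
  have hC' : ∀ i, ‖a' i‖ ≤ C := fun i => by
    by_cases hi : i ∈ F <;> simp [ha', hi, hC, hC0]
  have hsub : diagonalOp b a - diagonalOp b a' = diagonalOp b fun i => a i - a' i := by
    ext x
    refine ext_inner_basis b fun i => ?_
    rw [_root_.sub_apply, inner_sub_right, inner_diagonalOp b hC,
      inner_diagonalOp b hC', inner_diagonalOp b (C := C + C)
        fun i => (norm_sub_le _ _).trans (add_le_add (hC i) (hC' i)), sub_mul]
  have hrank : (diagonalOp b a' : H →ₗ[ℂ] H).rank ≤ (k : Cardinal) := by
    have h1 := rank_span_finset_le (R := ℂ) (F.image b)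
    have h2 : (((F.image b).card : ℕ) : Cardinal) ≤ (k : Cardinal) := by
      exact_mod_cast Finset.card_image_le.trans hk
    refine le_trans (Submodule.rank_mono ?_) (h1.trans h2)
    rintro _ ⟨x, rfl⟩
    have h3 : diagonalOp b a' x = ∑ i ∈ F, (a i * ⟪b i, x⟫_ℂ) • b i := by
      refine ext_inner_basis b fun j => ?_
      rw [inner_diagonalOp b hC', inner_sum]
      simp_rw [inner_smul_right, orthonormal_iff_ite.1 b.orthonormal]
      simp [ha', Finset.sum_ite_eq]
    rw [ContinuousLinearMap.coe_coe, h3]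
    refine Submodule.sum_mem _ fun i hi => Submodule.smul_mem _ _ (Submodule.subset_span ?_)
    exact Finset.mem_coe.2 (Finset.mem_image_of_mem _ hi)
  refine (singVal_le_norm_sub _ _ hrank).trans ?_
  rw [hsub]
  refine norm_diagonalOp_le b hr fun i => ?_
  by_cases hi : i ∈ F
  · simp [ha', hi, hr]
  · simpa [ha', hi] using hF i hi

/-- The singular values of a nonnegative diagonal operator have the same distribution as its
entries. -/
theorem encard_lt_singVal {a : ι → ℝ} {C : ℝ} (hC : ∀ i, a i ≤ C) (ha : ∀ i, 0 ≤ a i)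
    (h0 : Tendsto (singVal (diagonalOp b fun i => (a i : ℂ))) atTop (𝓝 0)) {r : ℝ} (hr : 0 < r) :
    {j | r < singVal (diagonalOp b fun i => (a i : ℂ)) j}.encard = {i | r < a i}.encard := by
  have hn : ∀ i, ‖(a i : ℂ)‖ = a i := fun i => by
    rw [Complex.norm_real, Real.norm_of_nonneg (ha i)]
  have hC' : ∀ i, ‖(a i : ℂ)‖ ≤ C := fun i => (hn i).trans_le (hC i)
  have hfin : {i | r < a i}.Finite := by
    by_contra hinf
    obtain ⟨k, hk⟩ := (h0.eventually_lt_const hr).exists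
    obtain ⟨F, hF, hcard⟩ := Set.Infinite.exists_subset_card_eq hinf (k + 1)
    exact hk.not_ge (le_singVal_diagonalOp b hC' hr.le (F := F)
      (fun i hi => (hn i).symm ▸ (hF hi).le) (by omega))
  have key : {j | r < singVal (diagonalOp b fun i => (a i : ℂ)) j} =
      (Finset.range hfin.toFinset.card : Set ℕ) := by
    ext j
    simp only [Set.mem_ofPred_eq, Finset.coe_range, Set.mem_Iio]
    constructor
    · intro h
      by_contra hj
      exact h.not_ge (singVal_diagonalOp_le b hC' hr.le (F := hfin.toFinset)
        (fun i hi => (hn i).trans_le (by simpa using hi)) (not_lt.1 hj))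
    · intro h
      -- The smallest entry above `r` turns the bound for singular values into a strict inequality.
      have hne : hfin.toFinset.Nonempty := Finset.card_pos.1 (by omega)
      obtain ⟨i₀, hi₀, hmin⟩ := Finset.exists_min_image hfin.toFinset a hne
      refine lt_of_lt_of_le (show r < a i₀ by simpa using hi₀) ?_
      exact le_singVal_diagonalOp b hC' (ha i₀) (fun i hi => (hn i).symm ▸ hmin i hi) h
  rw [key, Set.encard_coe_eq_coe_finsetCard, Finset.card_range, hfin.encard_eq_coe_toFinset_card]

/-- By the layer-cake formula a sum of p-th powers depends only on the number of terms above each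
level, and these numbers agree by `encard_lt_singVal`. Working in [0, ∞] requires no prior
summability. -/
theorem tsum_singVal_rpow {a : ι → ℝ} {C : ℝ} (hC : ∀ i, a i ≤ C) (ha : ∀ i, 0 ≤ a i)
    (h0 : Tendsto (singVal (diagonalOp b fun i => (a i : ℂ))) atTop (𝓝 0)) {p : ℝ} (hp : 0 < p) :
    ∑' j, ENNReal.ofReal (singVal (diagonalOp b fun i => (a i : ℂ)) j ^ p) =
      ∑' i, ENNReal.ofReal (a i ^ p) := by
  let _ : MeasurableSpace ι := ⊤
  rw [← lintegral_count, ← lintegral_count,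
    lintegral_rpow_eq_lintegral_meas_lt_mul _ (Eventually.of_forall fun j => singVal_nonneg _ j)
      measurable_from_top.aemeasurable hp,
    lintegral_rpow_eq_lintegral_meas_lt_mul _ (Eventually.of_forall ha)
      measurable_from_top.aemeasurable hp]
  congr 1
  refine setLIntegral_congr_fun measurableSet_Ioi fun t ht => ?_
  rw [Measure.count_apply MeasurableSpace.measurableSet_top,
    Measure.count_apply MeasurableSpace.measurableSet_top, encard_lt_singVal b hC ha h0 ht]

theorem hasSum_rpow_of_hasSum_singVal {a : ι → ℝ} {C : ℝ} (hC : ∀ i, a i ≤ C) (ha : ∀ i, 0 ≤ a i)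
    (h0 : Tendsto (singVal (diagonalOp b fun i => (a i : ℂ))) atTop (𝓝 0)) {p : ℝ} (hp : 0 < p)
    {t : ℝ} (h : HasSum (fun j => singVal (diagonalOp b fun i => (a i : ℂ)) j ^ p) t) :
    HasSum (fun i => a i ^ p) t := by
  have h1 := tsum_singVal_rpow b hC ha h0 hp
  have h2 : ∀ j, 0 ≤ singVal (diagonalOp b fun i => (a i : ℂ)) j ^ p := fun j =>
    Real.rpow_nonneg (singVal_nonneg _ j) p
  have h3 : ∀ i, 0 ≤ a i ^ p := fun i => Real.rpow_nonneg (ha i) p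
  rw [← ENNReal.ofReal_tsum_of_nonneg h2 h.summable, h.tsum_eq] at h1
  have hs : Summable fun i => a i ^ p := by
    have := ENNReal.summable_toReal (h1 ▸ ENNReal.ofReal_ne_top)
    simpa only [ENNReal.toReal_ofReal (h3 _)] using this
  rw [← ENNReal.ofReal_tsum_of_nonneg h3 hs,
    ENNReal.ofReal_eq_ofReal_iff (h.nonneg h2) (tsum_nonneg h3)] at h1
  rw [h1]
  exact hs.hasSum

end Diagonal

/-! ### The Abelian theorem for decreasing sequences with logarithmic partial sums -/

section Sequences

variable {μ : ℕ → ℝ} {C : ℝ}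

theorem mul_le_of_sum_le_log (hμ : Antitone μ)
    (hC : ∀ k : ℕ, ∑ j ∈ Finset.range k, μ j ≤ C * Real.log (1 + k)) (k : ℕ) :
    (k + 1) * μ k ≤ C * Real.log (2 + k) := by
  have h1 : (Finset.range (k + 1)).card • μ k ≤ ∑ j ∈ Finset.range (k + 1), μ j :=
    Finset.card_nsmul_le_sum _ _ _ fun j hj => hμ (Nat.lt_succ_iff.1 (Finset.mem_range.1 hj))
  have h2 := hC (k + 1)
  rw [Finset.card_range, nsmul_eq_mul] at h1
  push_cast at h1 h2
  rw [show (1 : ℝ) + (k + 1) = 2 + k by ring] at h2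
  exact h1.trans h2

theorem nonneg_of_sum_le_log (h0 : ∀ j, 0 ≤ μ j)
    (hC : ∀ k : ℕ, ∑ j ∈ Finset.range k, μ j ≤ C * Real.log (1 + k)) : 0 ≤ C := by
  have h1 := hC 1
  have h2 : (0 : ℝ) < Real.log (1 + (1 : ℕ)) := Real.log_pos (by norm_num)
  have h3 : 0 ≤ ∑ j ∈ Finset.range 1, μ j := Finset.sum_nonneg fun j _ => h0 j
  exact nonneg_of_mul_nonneg_left (h3.trans h1) h2

theorem summable_rpow_of_sum_le_log (hμ : Antitone μ) (h0 : ∀ j, 0 ≤ μ j)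
    (hC : ∀ k : ℕ, ∑ j ∈ Finset.range k, μ j ≤ C * Real.log (1 + k)) {s : ℝ} (hs : 1 < s) :
    Summable fun j => μ j ^ s := by
  have hC0 := nonneg_of_sum_le_log h0 hC
  -- The logarithm costs a power δ, leaving μ_j = O(j^{-(1-δ)}); this δ makes (1 - δ) s = (s + 1)/2
  -- > 1.
  set δ : ℝ := (s - 1) / (2 * s) with hδ
  have hδ0 : 0 < δ := by apply div_pos <;> linarith
  have hexp : 1 < (1 - δ) * s := by
    have : δ * s = (s - 1) / 2 := by rw [hδ]; field_simp
    linarith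
  have hle : ∀ j, μ j ≤ C * 2 ^ δ / δ * ((j + 1 : ℕ) : ℝ) ^ (-(1 - δ)) := fun j => by
    have h1 := mul_le_of_sum_le_log hμ hC j
    have h2 : Real.log (2 + j) ≤ (2 * (j + 1 : ℝ)) ^ δ / δ :=
      (Real.log_le_log (by positivity) (by linarith [(Nat.cast_nonneg j : (0 : ℝ) ≤ j)])).trans
        (Real.log_le_rpow_div (by positivity) hδ0)
    have hj : (0 : ℝ) < j + 1 := by positivity
    rw [Real.mul_rpow (by norm_num) hj.le] at h2
    have h3 : ((j : ℝ) + 1) ^ (-(1 - δ)) = (j + 1 : ℝ) ^ δ / (j + 1) := by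
      rw [neg_sub, Real.rpow_sub hj, Real.rpow_one]
    push_cast
    rw [h3, mul_div_assoc', le_div_iff₀ hj]
    calc μ j * (j + 1) ≤ C * Real.log (2 + j) := by linarith
      _ ≤ C * (2 ^ δ * (j + 1 : ℝ) ^ δ / δ) := by gcongr
      _ = _ := by ring
  have hsum : Summable fun j : ℕ => (C * 2 ^ δ / δ) ^ s * ((j + 1 : ℕ) : ℝ) ^ (-((1 - δ) * s)) :=
    ((summable_nat_add_iff 1).2 (Real.summable_nat_rpow.2 (by linarith))).mul_left _
  refine hsum.of_nonneg_of_le (fun j => Real.rpow_nonneg (h0 j) s) fun j => ?_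
  refine (Real.rpow_le_rpow (h0 j) (hle j) (by linarith)).trans_eq ?_
  rw [Real.mul_rpow (by positivity) (by positivity), ← Real.rpow_mul (by positivity)]
  ring_nf

theorem tendsto_zero_of_sum_le_log (hμ : Antitone μ) (h0 : ∀ j, 0 ≤ μ j)
    (hC : ∀ k : ℕ, ∑ j ∈ Finset.range k, μ j ≤ C * Real.log (1 + k)) :
    Tendsto μ atTop (𝓝 0) := by
  have h := (summable_rpow_of_sum_le_log hμ h0 hC (s := 2) (by norm_num)).tendsto_atTop_zero
  have h2 := (Real.continuous_sqrt.tendsto 0).comp h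
  simp only [Real.sqrt_zero, Function.comp_def] at h2
  refine h2.congr fun j => ?_
  rw [Real.rpow_two, Real.sqrt_sq (h0 j)]

/-- The sum of the terms of `μ` that are at least `r`. -/
noncomputable def sumGe (μ : ℕ → ℝ) (r : ℝ) : ℝ := ∑' j, if r ≤ μ j then μ j else 0

theorem summable_sumGe (h : Tendsto μ atTop (𝓝 0)) {r : ℝ} (hr : 0 < r) :
    Summable fun j => if r ≤ μ j then μ j else 0 := by
  refine summable_of_hasFiniteSupport ?_
  obtain ⟨N, hN⟩ := eventually_atTop.1 (h.eventually_lt_const hr)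
  refine (Set.finite_Iio N).subset fun j hj => ?_
  by_contra hjN
  exact hj (if_neg (not_le.2 (hN j (not_lt.1 hjN))))

theorem sumGe_nonneg (h0 : ∀ j, 0 ≤ μ j) (r : ℝ) : 0 ≤ sumGe μ r :=
  tsum_nonneg fun j => by split_ifs <;> simp [h0]

theorem sumGe_anti (h0 : ∀ j, 0 ≤ μ j) (h : Tendsto μ atTop (𝓝 0)) {r r' : ℝ} (hr : 0 < r)
    (hrr' : r ≤ r') : sumGe μ r' ≤ sumGe μ r := by
  refine (summable_sumGe h (hr.trans_le hrr')).tsum_le_tsum (fun j => ?_) (summable_sumGe h hr)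
  by_cases h1 : r' ≤ μ j
  · rw [if_pos h1, if_pos (hrr'.trans h1)]
  · rw [if_neg h1]; split_ifs <;> simp [h0]

theorem sum_le_sumGe_add (h0 : ∀ j, 0 ≤ μ j) (h : Tendsto μ atTop (𝓝 0)) {r : ℝ} (hr : 0 < r)
    (k : ℕ) : ∑ j ∈ Finset.range k, μ j ≤ sumGe μ r + k * r := by
  have h1 : ∑ j ∈ Finset.range k, μ j ≤
      ∑ j ∈ Finset.range k, ((if r ≤ μ j then μ j else 0) + r) :=
    Finset.sum_le_sum fun j _ => by split_ifs <;> linarith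
  rw [Finset.sum_add_distrib, Finset.sum_const, Finset.card_range, nsmul_eq_mul] at h1
  refine h1.trans (add_le_add_left ?_ _)
  exact (summable_sumGe h hr).sum_le_tsum _ fun j _ => by split_ifs <;> simp [h0]

theorem sumGe_le_sum (hμ : Antitone μ) (h0 : ∀ j, 0 ≤ μ j) {r : ℝ} {k : ℕ} (hk : μ k < r) :
    sumGe μ r ≤ ∑ j ∈ Finset.range k, μ j := by
  rw [sumGe, tsum_eq_sum (s := Finset.range k) fun j hj => if_neg (not_le.2 <|
    (hμ (by simpa using hj)).trans_lt hk)]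
  exact Finset.sum_le_sum fun j _ => by split_ifs <;> simp [h0]

/-- The change of variable k = e^{tu}, for which log k becomes tu; rounding alters the logarithm by
at most log 2. -/
theorem tendsto_sum_floor_exp_div {c : ℝ}
    (hγ : Tendsto (fun k : ℕ => (∑ j ∈ Finset.range k, μ j) / Real.log (1 + k)) atTop (𝓝 c))
    {t : ℝ} (ht : 0 < t) :
    Tendsto (fun u : ℝ => (∑ j ∈ Finset.range ⌊Real.exp (t * u)⌋₊, μ j) / u) atTop (𝓝 (c * t)) := by
  have hexp : Tendsto (fun u : ℝ => Real.exp (t * u)) atTop atTop :=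
    Real.tendsto_exp_atTop.comp (tendsto_id.const_mul_atTop ht)
  have h1 := hγ.comp (tendsto_nat_floor_atTop.comp hexp)
  have h2 : Tendsto (fun u : ℝ => Real.log (1 + ⌊Real.exp (t * u)⌋₊) / u) atTop (𝓝 t) := by
    have hup : Tendsto (fun u : ℝ => Real.log 2 / u + t) atTop (𝓝 t) := by
      simpa using (tendsto_const_nhds.div_atTop tendsto_id).add_const t
    refine tendsto_of_tendsto_of_tendsto_of_le_of_le' tendsto_const_nhds hup ?_ ?_
    · filter_upwards [eventually_gt_atTop 0] with u hu
      rw [le_div_iff₀ hu, ← Real.log_exp (t * u)]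
      refine Real.log_le_log (Real.exp_pos _) ?_
      rw [Real.log_exp]
      linarith [Nat.lt_floor_add_one (Real.exp (t * u))]
    · filter_upwards [eventually_gt_atTop 0] with u hu
      rw [div_le_iff₀ hu, add_mul, div_mul_cancel₀ _ hu.ne']
      have h3 : (1 : ℝ) + ⌊Real.exp (t * u)⌋₊ ≤ 2 * Real.exp (t * u) := by
        linarith [Nat.floor_le (Real.exp_pos (t * u)).le, Real.one_le_exp (mul_pos ht hu).le]
      refine (Real.log_le_log (by positivity) h3).trans ?_
      rw [Real.log_mul (by norm_num) (Real.exp_pos _).ne', Real.log_exp]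
  refine (h1.mul h2).congr' ?_
  filter_upwards [eventually_gt_atTop 0] with u hu
  have h4 : 0 < Real.log (1 + ⌊Real.exp (t * u)⌋₊) := by
    refine Real.log_pos ?_
    have : 1 ≤ ⌊Real.exp (t * u)⌋₊ := Nat.le_floor (by
      rw [Nat.cast_one]; exact Real.one_le_exp (mul_pos ht hu).le)
    have : (1 : ℝ) ≤ ⌊Real.exp (t * u)⌋₊ := by exact_mod_cast this
    linarith
  simp only [Function.comp_def]
  field_simp

/-- Since μ_k is at most C log(2+k)/(k+1), at k near e^{(1+δ)u} the product e^u μ_k is O(u e^{-δu})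
and tends to 0. So about e^{(1+δ)u} terms contain all those above the threshold e^{M-u}. -/
theorem eventually_lt_exp (hμ : Antitone μ) (h0 : ∀ j, 0 ≤ μ j)
    (hC : ∀ k : ℕ, ∑ j ∈ Finset.range k, μ j ≤ C * Real.log (1 + k)) (M : ℝ) {δ : ℝ} (hδ : 0 < δ) :
    ∀ᶠ u : ℝ in atTop, μ ⌊Real.exp ((1 + δ) * u)⌋₊ < Real.exp (M - u) := by
  have hC0 := nonneg_of_sum_le_log h0 hC
  have hlim : Tendsto (fun u : ℝ => C * (Real.log 3 * Real.exp (-(δ * u)) +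
      (1 + δ) / δ * ((δ * u) ^ 1 * Real.exp (-(δ * u))))) atTop (𝓝 0) := by
    have hδu : Tendsto (fun u : ℝ => δ * u) atTop atTop := tendsto_id.const_mul_atTop hδ
    have h1 := (Real.tendsto_pow_mul_exp_neg_atTop_nhds_zero 1).comp hδu
    have h2 := Real.tendsto_exp_neg_atTop_nhds_zero.comp hδu
    simpa using ((h2.const_mul (Real.log 3)).add (h1.const_mul ((1 + δ) / δ))).const_mul C
  filter_upwards [hlim.eventually_lt_const (Real.exp_pos M), eventually_ge_atTop 0] with u hu hu0
  set E := Real.exp ((1 + δ) * u) with hE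
  have hE0 : 0 < E := Real.exp_pos _
  have hE1 : 1 ≤ E := Real.one_le_exp (by positivity)
  have h1 := mul_le_of_sum_le_log hμ hC ⌊E⌋₊
  have h2 : Real.log (2 + ⌊E⌋₊) ≤ Real.log 3 + (1 + δ) * u := by
    rw [← Real.log_exp ((1 + δ) * u), ← Real.log_mul (by norm_num) hE0.ne']
    refine Real.log_le_log (by positivity) ?_
    linarith [Nat.floor_le hE0.le]
  have h3 : E * μ ⌊E⌋₊ ≤ C * (Real.log 3 + (1 + δ) * u) :=
    calc E * μ ⌊E⌋₊ ≤ (⌊E⌋₊ + 1) * μ ⌊E⌋₊ := by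
          gcongr
          · exact h0 _
          · exact (Nat.lt_floor_add_one E).le
      _ ≤ _ := h1.trans (by gcongr)
  have h4 : E * Real.exp (-(δ * u)) = Real.exp u := by
    rw [hE, ← Real.exp_add]; ring_nf
  have h5 : Real.exp u * μ ⌊E⌋₊ < Real.exp M := by
    refine lt_of_le_of_lt ?_ hu
    calc Real.exp u * μ ⌊E⌋₊ = E * μ ⌊E⌋₊ * Real.exp (-(δ * u)) := by rw [← h4]; ring
      _ ≤ C * (Real.log 3 + (1 + δ) * u) * Real.exp (-(δ * u)) := by gcongr
      _ = _ := by field_simp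
  rw [Real.exp_sub, lt_div_iff₀ (Real.exp_pos u)]
  linarith

/-- Sums over terms above a level behave like sums over initial segments. Below, the first e^u terms
lose at most e^M by discarding those under the threshold; above, `eventually_lt_exp` bounds the sum
by one over e^{(1+δ)u} terms, with δ arbitrarily small. -/
theorem tendsto_sumGe_exp_div (hμ : Antitone μ) (h0 : ∀ j, 0 ≤ μ j)
    (hC : ∀ k : ℕ, ∑ j ∈ Finset.range k, μ j ≤ C * Real.log (1 + k)) {c : ℝ}
    (hγ : Tendsto (fun k : ℕ => (∑ j ∈ Finset.range k, μ j) / Real.log (1 + k)) atTop (𝓝 c))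
    (M : ℝ) : Tendsto (fun u : ℝ => sumGe μ (Real.exp (M - u)) / u) atTop (𝓝 c) := by
  have hz := tendsto_zero_of_sum_le_log hμ h0 hC
  have hc : 0 ≤ c := ge_of_tendsto' hγ fun k => div_nonneg (Finset.sum_nonneg fun j _ => h0 j)
    (Real.log_nonneg (by linarith [(Nat.cast_nonneg k : (0 : ℝ) ≤ k)]))
  refine tendsto_order.2 ⟨fun a ha => ?_, fun a ha => ?_⟩
  · have h1 := (tendsto_sum_floor_exp_div hγ one_pos).sub
      (tendsto_const_nhds (x := Real.exp M) |>.div_atTop tendsto_id)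
    rw [mul_one, sub_zero] at h1
    filter_upwards [h1.eventually_const_lt ha, eventually_gt_atTop 0] with u hu hu0
    refine hu.trans_le ?_
    rw [id, ← sub_div]
    gcongr
    have h2 := sum_le_sumGe_add h0 hz (Real.exp_pos (M - u)) ⌊Real.exp (1 * u)⌋₊
    have h3 : (⌊Real.exp (1 * u)⌋₊ : ℝ) * Real.exp (M - u) ≤ Real.exp M :=
      calc (⌊Real.exp (1 * u)⌋₊ : ℝ) * Real.exp (M - u) ≤ Real.exp (1 * u) * Real.exp (M - u) := by
            gcongr; exact Nat.floor_le (Real.exp_pos _).le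
        _ = Real.exp M := by rw [← Real.exp_add]; ring_nf
    linarith
  -- Chosen so that c δ < a - c, with `c + 1` in place of `c` to allow `c = 0`.
  · set δ := (a - c) / (2 * (c + 1)) with hδ
    have hδ0 : 0 < δ := div_pos (by linarith) (by linarith)
    have hlt : c * (1 + δ) < a := by
      have : δ * (c + 1) = (a - c) / 2 := by rw [hδ]; field_simp
      nlinarith
    filter_upwards [(tendsto_sum_floor_exp_div hγ (by linarith : 0 < 1 + δ)).eventually_lt_const hlt,
      eventually_lt_exp hμ h0 hC M hδ0, eventually_gt_atTop 0] with u hu hu1 hu0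
    refine lt_of_le_of_lt ?_ hu
    gcongr
    exact sumGe_le_sum hμ h0 hu1

/-- The condition on v is v ≥ (M - log x)/κ, which is nonnegative because x ≤ e^M, so the integral
is x exp(-(M - log x)/κ). This is how a power 1 + 1/κ arises from a threshold. -/
theorem integral_exp_neg_mul_ite {M κ x : ℝ} (hκ : 0 < κ) (hx : 0 ≤ x) (hxM : x ≤ Real.exp M) :
    IntegrableOn (fun v => Real.exp (-v) * if Real.exp (M - κ * v) ≤ x then x else 0) (Set.Ioi 0) ∧
    ∫ v in Set.Ioi (0 : ℝ), Real.exp (-v) * (if Real.exp (M - κ * v) ≤ x then x else 0) =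
      Real.exp (-(M / κ)) * x ^ (1 + 1 / κ) := by
  rcases hx.eq_or_lt with rfl | hx
  · simp [Real.zero_rpow (by positivity : 1 + κ⁻¹ ≠ 0)]
  set v₀ := (M - Real.log x) / κ with hv
  have hlog : Real.log x ≤ M := by rwa [Real.log_le_iff_le_exp hx]
  have hv0 : 0 ≤ v₀ := div_nonneg (by linarith) hκ.le
  have hfun : (fun v => Real.exp (-v) * if Real.exp (M - κ * v) ≤ x then x else 0) =
      (Set.Ici v₀).indicator fun v => Real.exp (-v) * x := by
    ext v
    have hiff : Real.exp (M - κ * v) ≤ x ↔ v ∈ Set.Ici v₀ := by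
      rw [← Real.le_log_iff_exp_le hx, Set.mem_Ici, hv, div_le_iff₀ hκ]
      constructor <;> intro h <;> linarith
    by_cases h : v ∈ Set.Ici v₀
    · rw [if_pos (hiff.2 h), Set.indicator_of_mem h]
    · rw [if_neg fun h' => h (hiff.1 h'), Set.indicator_of_notMem h, mul_zero]
  have hint : IntegrableOn (fun v => Real.exp (-v) * x) (Set.Ioi 0) :=
    (integrableOn_exp_neg_Ioi 0).mul_const x
  rw [hfun]
  refine ⟨hint.indicator measurableSet_Ici, ?_⟩
  have hval : Real.exp (-v₀) * x = Real.exp (-(M / κ)) * x ^ (1 + 1 / κ) := by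
    rw [Real.rpow_add hx, Real.rpow_one, Real.rpow_def_of_pos hx,
      show -v₀ = -(M / κ) + Real.log x * (1 / κ) by rw [hv]; ring, Real.exp_add]
    ring
  have hset : (Set.Ioi (0 : ℝ) ∩ Set.Ici v₀ : Set ℝ) =ᵐ[volume] Set.Ioi v₀ := by
    have h := (ae_eq_refl (Set.Ioi (0 : ℝ))).inter (Ioi_ae_eq_Ici (a := v₀) (μ := volume)).symm
    rwa [Set.Ioi_inter_Ioi, max_eq_right hv0] at h
  rw [setIntegral_indicator measurableSet_Ici, setIntegral_congr_set hset, integral_mul_const,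
    integral_exp_neg_Ioi, hval]

theorem tsum_rpow_eq_integral (hμ : Antitone μ) (h0 : ∀ j, 0 ≤ μ j)
    (hC : ∀ k : ℕ, ∑ j ∈ Finset.range k, μ j ≤ C * Real.log (1 + k)) {M κ : ℝ} (hκ : 0 < κ)
    (hM : ∀ j, μ j ≤ Real.exp M) :
    Real.exp (-(M / κ)) * ∑' j, μ j ^ (1 + 1 / κ) =
      ∫ v in Set.Ioi (0 : ℝ), Real.exp (-v) * sumGe μ (Real.exp (M - κ * v)) := by
  have hs := (summable_rpow_of_sum_le_log hμ h0 hC (s := 1 + 1 / κ)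
    (by linarith [one_div_pos.2 hκ])).mul_left (Real.exp (-(M / κ)))
  have h1 := fun j => integral_exp_neg_mul_ite hκ (h0 j) (hM j)
  have h2 := hasSum_integral_of_summable_integral_norm
    (F := fun j v => Real.exp (-v) * (if Real.exp (M - κ * v) ≤ μ j then μ j else 0))
    (μ := volume.restrict (Set.Ioi (0 : ℝ))) (fun j => (h1 j).1) (by
      refine hs.congr fun j => ?_
      rw [← (h1 j).2]
      congr 1
      ext v
      refine (Real.norm_of_nonneg (mul_nonneg (Real.exp_pos _).le ?_)).symm
      split_ifs <;> simp [h0])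
  simp_rw [(h1 _).2, tsum_mul_left] at h2
  rw [← tsum_mul_left]
  exact h2.tsum_eq

/-- Supplies the dominating function: the limit gives linear growth for large u, monotonicity in the
threshold bounds the rest. -/
theorem exists_sumGe_exp_le (h0 : ∀ j, 0 ≤ μ j) (hz : Tendsto μ atTop (𝓝 0)) {M c : ℝ}
    (hβ : Tendsto (fun u : ℝ => sumGe μ (Real.exp (M - u)) / u) atTop (𝓝 c)) :
    ∃ K, 0 ≤ K ∧ ∀ u, 0 ≤ u → sumGe μ (Real.exp (M - u)) ≤ K * (1 + u) := by
  obtain ⟨u₀, hu₀⟩ := eventually_atTop.1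
    ((hβ.eventually_lt_const (lt_add_one c)).and (eventually_gt_atTop 0))
  have hu1 : 0 < u₀ := (hu₀ u₀ le_rfl).2
  set K := |c + 1| + sumGe μ (Real.exp (M - u₀)) with hK
  have hS := sumGe_nonneg h0 (Real.exp (M - u₀))
  have habs := abs_nonneg (c + 1)
  refine ⟨K, by positivity, fun u hu => ?_⟩
  rcases le_total u₀ u with h | h
  · have h1 := (hu₀ u h).1
    rw [div_lt_iff₀ (hu₀ u h).2] at h1
    nlinarith [le_abs_self (c + 1)]
  · have := sumGe_anti h0 hz (Real.exp_pos (M - u₀)) (Real.exp_le_exp.2 (by linarith : M - u₀ ≤ M - u))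
    nlinarith

/-- An Abelian theorem: if `∑_{j<k} μ_j ∼ c log k`, then `(1/k) ∑ μ_j^(1+1/k) → c`. -/
theorem tendsto_zeta_of_tendsto_gamma (hμ : Antitone μ) (h0 : ∀ j, 0 ≤ μ j)
    (hC : ∀ k : ℕ, ∑ j ∈ Finset.range k, μ j ≤ C * Real.log (1 + k)) {c : ℝ}
    (hγ : Tendsto (fun k : ℕ => (∑ j ∈ Finset.range k, μ j) / Real.log (1 + k)) atTop (𝓝 c)) :
    Tendsto (fun i : ℕ => 1 / ((i + 1 : ℕ) : ℝ) * ∑' j, μ j ^ (1 + 1 / ((i + 1 : ℕ) : ℝ)))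
      atTop (𝓝 c) := by
  have hz := tendsto_zero_of_sum_le_log hμ h0 hC
  obtain ⟨M, hM⟩ : ∃ M, ∀ j, μ j ≤ Real.exp M :=
    ⟨μ 0, fun j => (hμ (Nat.zero_le j)).trans (by linarith [Real.add_one_le_exp (μ 0)])⟩
  have hβ := tendsto_sumGe_exp_div hμ h0 hC hγ M
  obtain ⟨K, hK0, hK⟩ := exists_sumGe_exp_le h0 hz hβ
  have hk : Tendsto (fun i : ℕ => ((i + 1 : ℕ) : ℝ)) atTop atTop :=
    tendsto_natCast_atTop_atTop.comp (tendsto_add_atTop_nat 1)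
  have hG : ∀ m : ℝ, 0 < m → IntegrableOn (fun v : ℝ => Real.exp (-v) * v ^ (m - 1)) (Set.Ioi 0) :=
    fun m hm => Real.GammaIntegral_convergent hm
  have hG1 : IntegrableOn (fun v : ℝ => Real.exp (-v) * v) (Set.Ioi 0) := by
    have := hG 2 (by norm_num)
    norm_num at this
    exact this
  have hdct : Tendsto (fun i : ℕ => ∫ v in Set.Ioi (0 : ℝ),
      1 / ((i + 1 : ℕ) : ℝ) * (Real.exp (-v) * sumGe μ (Real.exp (M - ((i + 1 : ℕ) : ℝ) * v))))
      atTop (𝓝 (∫ v in Set.Ioi (0 : ℝ), c * (Real.exp (-v) * v))) := by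
    refine tendsto_integral_of_dominated_convergence (fun v => K * (Real.exp (-v) + Real.exp (-v) * v))
      (fun i => ?_) (((integrableOn_exp_neg_Ioi 0).add hG1).const_mul K) (fun i => ?_) ?_
    · have hmono : Monotone fun v : ℝ => sumGe μ (Real.exp (M - ((i + 1 : ℕ) : ℝ) * v)) :=
        fun v w hvw => sumGe_anti h0 hz (Real.exp_pos _) (Real.exp_le_exp.2 (by gcongr))
      exact (((Real.measurable_exp.comp measurable_neg).mul hmono.measurable).const_mul
        _).aestronglyMeasurable
    · refine (ae_restrict_iff' measurableSet_Ioi).2 (Eventually.of_forall fun v hv => ?_)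
      have hv : (0 : ℝ) < v := hv
      have hi : (1 : ℝ) ≤ ((i + 1 : ℕ) : ℝ) := by exact_mod_cast Nat.succ_le_succ (Nat.zero_le i)
      have hS := sumGe_nonneg h0 (Real.exp (M - ((i + 1 : ℕ) : ℝ) * v))
      rw [Real.norm_of_nonneg (by positivity), one_div, inv_mul_le_iff₀ (by linarith)]
      have h1 := hK (((i + 1 : ℕ) : ℝ) * v) (by positivity)
      -- As k = i + 1 ≥ 1, dividing K (1 + k v) by k leaves at most K (1 + v), uniformly in k.
      have h2 : K * (1 + ((i + 1 : ℕ) : ℝ) * v) ≤ ((i + 1 : ℕ) : ℝ) * (K * (1 + v)) := by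
        nlinarith
      calc Real.exp (-v) * sumGe μ (Real.exp (M - ((i + 1 : ℕ) : ℝ) * v))
          ≤ Real.exp (-v) * (((i + 1 : ℕ) : ℝ) * (K * (1 + v))) := by gcongr; exact h1.trans h2
        _ = _ := by ring
    · refine (ae_restrict_iff' measurableSet_Ioi).2 (Eventually.of_forall fun v hv => ?_)
      have hv : (0 : ℝ) < v := hv
      have h1 := (hβ.comp (hk.atTop_mul_const hv)).const_mul (Real.exp (-v) * v)
      rw [show Real.exp (-v) * v * c = c * (Real.exp (-v) * v) by ring] at h1
      refine h1.congr fun i => ?_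
      have hi : ((i + 1 : ℕ) : ℝ) ≠ 0 := by positivity
      simp only [Function.comp_def]
      field_simp
  -- The integral is c Γ(2) = c.
  have hint : ∫ v in Set.Ioi (0 : ℝ), c * (Real.exp (-v) * v) = c := by
    rw [integral_const_mul]
    have := Real.Gamma_eq_integral (s := 2) (by norm_num)
    norm_num at this
    rw [← this, mul_one]
  rw [hint] at hdct
  have hexp : Tendsto (fun i : ℕ => Real.exp (M / ((i + 1 : ℕ) : ℝ))) atTop (𝓝 1) := by
    have := (Real.continuous_exp.tendsto 0).comp
      (tendsto_const_nhds (x := M) |>.div_atTop hk)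
    rwa [Real.exp_zero] at this
  have h := hexp.mul hdct
  rw [one_mul] at h
  refine h.congr fun i => ?_
  rw [integral_const_mul, ← tsum_rpow_eq_integral hμ h0 hC (by positivity) hM, Real.exp_neg]
  have := (Real.exp_pos (M / ((i + 1 : ℕ) : ℝ))).ne'
  field_simp

end Sequences

/-! ### States in `DL₂` from dyadic means, and Banach limits -/

section States

theorem norm_apply_le (a : EllInfty) (k : ℕ) : ‖a k‖ ≤ ‖a‖ :=
  lp.norm_apply_le_norm ENNReal.top_ne_zero a k

/-- The mean of `a` over the points `2^(w p), …, 2^(w p + √p)`. -/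
noncomputable def dyadicMean (w : ℕ → ℕ) (a : EllInfty) (p : ℕ) : ℂ :=
  ((Nat.sqrt p + 1 : ℕ) : ℂ)⁻¹ * ∑ i ∈ Finset.range (Nat.sqrt p + 1), a (2 ^ (w p + i))

theorem norm_dyadicMean_le (w : ℕ → ℕ) (a : EllInfty) (p : ℕ) : ‖dyadicMean w a p‖ ≤ ‖a‖ := by
  rw [dyadicMean, norm_mul, norm_inv, Complex.norm_natCast, inv_mul_le_iff₀ (by positivity)]
  refine (norm_sum_le _ _).trans ((Finset.sum_le_sum fun i _ => norm_apply_le a _).trans_eq ?_)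
  rw [Finset.sum_const, Finset.card_range, nsmul_eq_mul]

theorem re_dyadicMean (w : ℕ → ℕ) (a : EllInfty) (p : ℕ) :
    (dyadicMean w a p).re =
      ((Nat.sqrt p + 1 : ℕ) : ℝ)⁻¹ *
        ∑ i ∈ Finset.range (Nat.sqrt p + 1), (a (2 ^ (w p + i))).re := by
  rw [dyadicMean, ← Complex.ofReal_natCast, ← Complex.ofReal_inv, Complex.re_ofReal_mul,
    Complex.re_sum]

theorem le_re_dyadicMean {w : ℕ → ℕ} {a : EllInfty} {p : ℕ} {y : ℝ}
    (h : ∀ i ≤ Nat.sqrt p, y ≤ (a (2 ^ (w p + i))).re) : y ≤ (dyadicMean w a p).re := by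
  rw [re_dyadicMean, le_inv_mul_iff₀ (by positivity)]
  have := Finset.card_nsmul_le_sum (Finset.range (Nat.sqrt p + 1))
    (fun i => (a (2 ^ (w p + i))).re) y fun i hi => h i (Nat.lt_succ_iff.1 (Finset.mem_range.1 hi))
  rwa [Finset.card_range, nsmul_eq_mul] at this

theorem dyadicMean_neg (w : ℕ → ℕ) (a : EllInfty) (p : ℕ) :
    dyadicMean w (-a) p = -dyadicMean w a p := by
  simp [dyadicMean]

theorem re_dyadicMean_le {w : ℕ → ℕ} {a : EllInfty} {p : ℕ} {y : ℝ}
    (h : ∀ i ≤ Nat.sqrt p, (a (2 ^ (w p + i))).re ≤ y) : (dyadicMean w a p).re ≤ y := by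
  have := le_re_dyadicMean (w := w) (a := -a) (p := p) (y := -y) fun i hi => by
    simpa using h i hi
  rw [dyadicMean_neg, Complex.neg_re] at this
  linarith

/-- Limits of dyadic means along an ultrafilter exist and form a bounded functional. -/
theorem exists_tendsto_dyadicMean (U : Ultrafilter ℕ) (w : ℕ → ℕ) :
    ∃ ω : EllInfty →L[ℂ] ℂ, ∀ a, Tendsto (dyadicMean w a) U (𝓝 (ω a)) := by
  have hex : ∀ a : EllInfty, ∃ z : ℂ, ‖z‖ ≤ ‖a‖ ∧ Tendsto (dyadicMean w a) U (𝓝 z) := by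
    intro a
    have hmem : ((U.map (dyadicMean w a) : Ultrafilter ℂ) : Filter ℂ) ≤
        𝓟 (Metric.closedBall 0 ‖a‖) := by
      rw [le_principal_iff]
      refine Ultrafilter.mem_map.2 (Filter.univ_mem' fun p => ?_)
      simpa using norm_dyadicMean_le w a p
    obtain ⟨z, hz, hle⟩ := (isCompact_closedBall (0 : ℂ) ‖a‖).ultrafilter_le_nhds _ hmem
    exact ⟨z, by simpa using hz, hle⟩
  choose f hf hlim using hex
  refine ⟨LinearMap.mkContinuous
    { toFun := f
      map_add' := fun a b => tendsto_nhds_unique (hlim (a + b)) <|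
        ((hlim a).add (hlim b)).congr fun p => by
          simp [dyadicMean, Finset.sum_add_distrib, mul_add]
      map_smul' := fun c a => tendsto_nhds_unique (hlim (c • a)) <|
        ((hlim a).const_mul c).congr fun p => by
          simp only [dyadicMean, lp.coeFn_smul, Pi.smul_apply, smul_eq_mul, ← Finset.mul_sum]
          ring } 1 fun a => by simpa using hf a, hlim⟩

theorem le_re_of_tendsto_dyadicMean {U : Ultrafilter ℕ} (hU : (U : Filter ℕ) ≤ atTop) {w : ℕ → ℕ}
    (hw : Tendsto w atTop atTop) {a : EllInfty} {z : ℂ} (hz : Tendsto (dyadicMean w a) U (𝓝 z))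
    {y : ℝ} (hy : ∀ᶠ k in atTop, y ≤ (a k).re) : y ≤ z.re := by
  obtain ⟨K, hK⟩ := eventually_atTop.1 hy
  refine ge_of_tendsto ((Complex.continuous_re.tendsto z).comp hz) ?_
  filter_upwards [hU (hw.eventually_ge_atTop K)] with p hp
  refine le_re_dyadicMean fun i _ => hK _ ?_
  have hp : K ≤ w p := hp
  exact hp.trans ((Nat.le_add_right _ i).trans Nat.lt_two_pow_self.le)

theorem tendsto_inv_sqrt : Tendsto (fun p : ℕ => ((Nat.sqrt p + 1 : ℕ) : ℝ)⁻¹) atTop (𝓝 0) := by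
  have h : Tendsto Nat.sqrt atTop atTop :=
    tendsto_atTop.2 fun m => by
      filter_upwards [eventually_ge_atTop (m * m)] with p hp using Nat.le_sqrt.2 hp
  exact tendsto_inv_atTop_zero.comp (tendsto_natCast_atTop_atTop.comp
    ((tendsto_add_atTop_nat 1).comp h))

/-- On indices that are powers of two, dilation is a unit shift of the exponent, so the difference
telescopes to two end terms. `1 ≤ w p` keeps the lowest exponent from being truncated at 0. -/
theorem dyadicMean_dilateTwo_sub {w : ℕ → ℕ} (a : EllInfty) {p : ℕ} (hp : 1 ≤ w p) :
    ‖dyadicMean w (dilateTwo a) p - dyadicMean w a p‖ ≤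
      ((Nat.sqrt p + 1 : ℕ) : ℝ)⁻¹ * (2 * ‖a‖) := by
  have h1 : dyadicMean w (dilateTwo a) p - dyadicMean w a p =
      ((Nat.sqrt p + 1 : ℕ) : ℂ)⁻¹ * (a (2 ^ (w p + 0 - 1)) - a (2 ^ (w p + (Nat.sqrt p + 1) - 1))) := by
    rw [dyadicMean, dyadicMean, ← mul_sub, ← Finset.sum_sub_distrib,
      ← Finset.sum_range_sub' fun i => a (2 ^ (w p + i - 1))]
    congr 1
    refine Finset.sum_congr rfl fun i _ => ?_
    obtain ⟨m, hm⟩ : ∃ m, w p + i = m + 1 := ⟨w p + i - 1, by omega⟩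
    rw [← add_assoc, hm, Nat.add_sub_cancel, Nat.add_sub_cancel]
    congr 1
    change a (2 ^ (m + 1) / 2) = _
    rw [pow_succ, Nat.mul_div_cancel _ two_pos]
  rw [h1, norm_mul, norm_inv, Complex.norm_natCast, two_mul]
  gcongr
  exact (norm_sub_le _ _).trans (add_le_add (norm_apply_le a _) (norm_apply_le a _))

theorem isDL2_of_tendsto_dyadicMean {U : Ultrafilter ℕ} (hU : (U : Filter ℕ) ≤ atTop) {w : ℕ → ℕ}
    (hw : Tendsto w atTop atTop) {ω : EllInfty →L[ℂ] ℂ}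
    (hω : ∀ a, Tendsto (dyadicMean w a) U (𝓝 (ω a))) (H : Type*) [NormedAddCommGroup H]
    [InnerProductSpace ℂ H] [CompleteSpace H] : IsDL2 H ω := by
  refine ⟨⟨fun a ha => ?_, ?_⟩, fun a ha => ?_, fun T hT _ => ?_⟩
  · refine ge_of_tendsto' (hω a) fun p => mul_nonneg ?_ (Finset.sum_nonneg fun i _ => ha _)
    rw [← Complex.ofReal_natCast, ← Complex.ofReal_inv]
    exact Complex.zero_le_real.2 (by positivity)
  · refine tendsto_nhds_unique (hω 1) (tendsto_const_nhds.congr fun p => ?_)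
    have h1 : ∀ k : ℕ, (1 : EllInfty) k = 1 := fun k => by simp
    rw [dyadicMean]
    simp_rw [h1]
    rw [Finset.sum_const, Finset.card_range, nsmul_eq_mul, mul_one, inv_mul_cancel₀]
    exact Nat.cast_ne_zero.2 (Nat.succ_ne_zero _)
  · have hb : ∀ k, |(a k).re| ≤ ‖a‖ := fun k =>
      (Complex.abs_re_le_norm _).trans (norm_apply_le a k)
    have hbge : IsBoundedUnder (· ≥ ·) atTop fun k => (a k).re :=
      isBoundedUnder_of ⟨-‖a‖, fun k => (abs_le.1 (hb k)).1⟩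
    have hble : IsBoundedUnder (· ≤ ·) atTop fun k => (a k).re :=
      isBoundedUnder_of ⟨‖a‖, fun k => (abs_le.1 (hb k)).2⟩
    refine ⟨le_of_forall_lt fun y hy => ?_, le_of_forall_gt fun y hy => ?_⟩
    · obtain ⟨y', hy1, hy2⟩ := exists_between hy
      exact hy1.trans_le (le_re_of_tendsto_dyadicMean hU hw (hω a)
        ((eventually_lt_of_lt_liminf hy2 hbge).mono fun k hk => hk.le))
    · obtain ⟨y', hy1, hy2⟩ := exists_between hy
      have := le_re_of_tendsto_dyadicMean hU hw (a := -a) (y := -y') (hω (-a))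
        ((eventually_lt_of_limsup_lt hy1 hble).mono fun k hk => by
          simpa using hk.le)
      rw [map_neg, Complex.neg_re] at this
      linarith
  · refine tendsto_nhds_unique (hω _) ?_
    have h1 := (tendsto_inv_sqrt.mul_const (2 * ‖(⟨gammaSeq T, hT.2⟩ : EllInfty)‖)).mono_left hU
    rw [zero_mul] at h1
    have h2 := squeeze_zero_norm' (a := _) (by
      filter_upwards [hU (hw.eventually_ge_atTop 1)] with p hp
      exact dyadicMean_dilateTwo_sub ⟨gammaSeq T, hT.2⟩ hp) h1
    have h3 := h2.add (hω ⟨gammaSeq T, hT.2⟩)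
    simpa using h3

/-! ### Banach limits of convergent sequences -/

theorem IsBanachLimit.apply_of_tendsto {ω : EllInfty →L[ℂ] ℂ} (hω : IsBanachLimit ω)
    {a : EllInfty} {z : ℂ} (ha : Tendsto (fun k => a k) atTop (𝓝 z)) : ω a = z := by
  have h1 : ∀ k : ℕ, (1 : EllInfty) k = 1 := fun k => by simp
  rw [← sub_eq_zero, ← norm_le_zero_iff]
  refine le_of_forall_pos_le_add fun ε hε => ?_
  set δ := ε / (‖ω‖ + 1) with hδ
  have hδ0 : 0 < δ := by positivity
  obtain ⟨K, hK⟩ := eventually_atTop.1 ((tendsto_iff_norm_sub_tendsto_zero.1 ha).eventually_lt_const hδ0)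
  -- Translation invariance replaces `a` by a tail that is uniformly close to `z`.
  have h2 : ω a - z = ω (shift K a - z • 1) := by
    rw [map_sub, map_smul, hω.2, hω.1.map_one, smul_eq_mul, mul_one]
  have h3 : ‖shift K a - z • 1‖ ≤ δ := by
    refine lp.norm_le_of_forall_le hδ0.le fun k => ?_
    rw [lp.coeFn_sub, Pi.sub_apply, lp.coeFn_smul, Pi.smul_apply, h1, smul_eq_mul, mul_one]
    exact (hK (k + K) (Nat.le_add_left _ _)).le
  rw [h2, zero_add]
  refine (ω.le_opNorm_of_le h3).trans ?_
  rw [hδ, mul_div_assoc', div_le_iff₀ (by positivity)]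
  nlinarith [norm_nonneg ω]

end States

/-! ### From dyadic means to convergence -/

section Tauberian

variable {S : ℕ → ℝ} {C : ℝ}

theorem log_two_pow_add_two_le {e : ℕ} (he : 1 ≤ e) :
    Real.log (1 + ((2 ^ e + 1 : ℕ) : ℝ)) ≤ (e + 1) * Real.log 2 := by
  have h1 : (2 : ℝ) ≤ 2 ^ e := by
    simpa using pow_le_pow_right₀ (by norm_num : (1 : ℝ) ≤ 2) he
  have : (e + 1) * Real.log 2 = Real.log (2 ^ (e + 1)) := by
    rw [Real.log_pow]; push_cast; ring
  rw [this]
  refine Real.log_le_log (by positivity) ?_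
  push_cast
  rw [pow_succ]
  linarith

theorem le_log_two_pow_add_two (e : ℕ) :
    e * Real.log 2 ≤ Real.log (1 + ((2 ^ e + 1 : ℕ) : ℝ)) := by
  rw [← Real.log_pow]
  refine Real.log_le_log (by positivity) ?_
  push_cast
  linarith

theorem tendsto_sqrt_div : Tendsto (fun p : ℕ => (Nat.sqrt p : ℝ) / p) atTop (𝓝 0) := by
  have h := tendsto_inv_sqrt.const_mul 2
  rw [mul_zero] at h
  refine squeeze_zero' (Eventually.of_forall fun p => by positivity) ?_ h
  filter_upwards [eventually_ge_atTop 1] with p hp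
  have h1 : ((Nat.sqrt p : ℕ) : ℝ) * Nat.sqrt p ≤ p := by exact_mod_cast Nat.sqrt_le p
  have h2 : (1 : ℝ) ≤ Nat.sqrt p := by exact_mod_cast Nat.sqrt_pos.2 hp
  have h3 : (0 : ℝ) < p := by exact_mod_cast hp
  rw [← div_eq_mul_inv, div_le_div_iff₀ h3 (by positivity)]
  push_cast
  nlinarith

/-- If the dyadic means of `S k / log (1 + k)` over long windows starting and ending at `2^p`
all have the limit `c`, then `S (2^p) / log (2^p) → c`. -/
theorem tendsto_dyadic_of_means (hS : Monotone S) (hS0 : ∀ k, 0 ≤ S k)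
    (hC : ∀ k : ℕ, S k ≤ C * Real.log (1 + k)) {γ : EllInfty}
    (hγ : ∀ i, (γ i).re = S (i + 1) / Real.log (1 + ((i + 1 : ℕ) : ℝ))) {c : ℝ}
    (hmean : ∀ U : Ultrafilter ℕ, (U : Filter ℕ) ≤ atTop → ∀ w : ℕ → ℕ, Tendsto w atTop atTop →
      Tendsto (fun p => (dyadicMean w γ p).re) U (𝓝 c)) :
    Tendsto (fun e : ℕ => S (2 ^ e + 1) / (e * Real.log 2)) atTop (𝓝 c) := by
  have hl2 : 0 < Real.log 2 := Real.log_pos (by norm_num)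
  have hC0 : 0 ≤ C := by
    have h1 := (hS0 1).trans (hC 1)
    exact nonneg_of_mul_nonneg_left h1 (Real.log_pos (by norm_num))
  -- Along each ultrafilter the bounded sequence has some limit `l`; comparing it with window means
  -- along the same ultrafilter identifies it as `c`.
  rw [tendsto_iff_ultrafilter]
  intro U hU
  have hmem : ((U.map fun e : ℕ => S (2 ^ e + 1) / (e * Real.log 2) : Ultrafilter ℝ) : Filter ℝ) ≤
      𝓟 (Set.Icc 0 (2 * C)) := by
    rw [le_principal_iff]
    change ∀ᶠ e in (U : Filter ℕ), _
    filter_upwards [hU (eventually_ge_atTop 1)] with e he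
    have he : 1 ≤ e := he
    have he' : (1 : ℝ) ≤ e := by exact_mod_cast he
    refine ⟨div_nonneg (hS0 _) (by positivity), ?_⟩
    rw [div_le_iff₀ (by positivity)]
    calc S (2 ^ e + 1) ≤ C * ((e + 1) * Real.log 2) :=
          (hC _).trans (mul_le_mul_of_nonneg_left (log_two_pow_add_two_le he) hC0)
      _ ≤ C * ((e + e) * Real.log 2) := by gcongr
      _ = _ := by ring
  obtain ⟨l, -, hle⟩ := (isCompact_Icc (a := (0 : ℝ)) (b := 2 * C)).ultrafilter_le_nhds _ hmem
  have hl : Tendsto (fun e : ℕ => S (2 ^ e + 1) / (e * Real.log 2)) U (𝓝 l) := hle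
  have hs := tendsto_sqrt_div.mono_left hU
  have hinv : Tendsto (fun p : ℕ => (1 : ℝ) / p) U (𝓝 0) :=
    tendsto_one_div_atTop_nhds_zero_nat.mono_left hU
  have hpos := hU (eventually_gt_atTop 1)
  -- The window begins at exponent p: S is at least S(2^p + 1) on it, and the logarithms exceed p
  -- log 2 by a factor at most 1 + √p/p + 1/p.
  have hup : l ≤ c := by
    have h1 := hl.mul (((hs.const_add (1 : ℝ)).add hinv).inv₀ (by norm_num))
    rw [add_zero, add_zero, inv_one, mul_one] at h1
    refine le_of_tendsto_of_tendsto h1 (hmean U hU id tendsto_id) ?_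
    filter_upwards [hpos] with p hp
    have hp : 1 < p := hp
    have hp' : (0 : ℝ) < p := by positivity
    refine le_re_dyadicMean fun i hi => ?_
    rw [hγ, id]
    have hi' : (i : ℝ) ≤ Nat.sqrt p := by exact_mod_cast hi
    have h2 := log_two_pow_add_two_le (e := p + i) (by omega)
    have h3 : 0 < Real.log (1 + ((2 ^ (p + i) + 1 : ℕ) : ℝ)) := Real.log_pos (by
      push_cast; linarith [pow_pos (two_pos : (0 : ℝ) < 2) (p + i)])
    calc S (2 ^ p + 1) / (p * Real.log 2) * (1 + (Nat.sqrt p : ℝ) / p + 1 / (p : ℝ))⁻¹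
        = S (2 ^ p + 1) / ((p + Nat.sqrt p + 1) * Real.log 2) := by field_simp
      _ ≤ S (2 ^ p + 1) / Real.log (1 + ((2 ^ (p + i) + 1 : ℕ) : ℝ)) := by
          refine div_le_div_of_nonneg_left (hS0 _) h3 (h2.trans ?_)
          push_cast
          gcongr
      _ ≤ S (2 ^ (p + i) + 1) / Real.log (1 + ((2 ^ (p + i) + 1 : ℕ) : ℝ)) := by
          gcongr
          refine hS (Nat.succ_le_succ (Nat.pow_le_pow_right two_pos (Nat.le_add_right _ _)))
  -- The window now ends at exponent p: S is at most S(2^p + 1) on it, and the logarithms are at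
  -- least (p - √p) log 2.
  have hdown : c ≤ l := by
    have hw : Tendsto (fun p : ℕ => p - Nat.sqrt p) atTop atTop := by
      refine tendsto_atTop.2 fun m => ?_
      filter_upwards [eventually_ge_atTop (2 * m), eventually_ge_atTop 4] with p hp hp4
      have h1 : 2 ≤ Nat.sqrt p := Nat.le_sqrt.2 hp4
      have h2 := Nat.sqrt_le p
      have h3 : 2 * Nat.sqrt p ≤ p := (Nat.mul_le_mul_right _ h1).trans h2
      omega
    have h1 := hl.mul ((hs.const_sub (1 : ℝ)).inv₀ (by norm_num))
    rw [sub_zero, inv_one, mul_one] at h1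
    refine le_of_tendsto_of_tendsto (hmean U hU _ hw) h1 ?_
    filter_upwards [hpos] with p hp
    have hp : 1 < p := hp
    have hp' : (0 : ℝ) < p := by positivity
    have hsq : Nat.sqrt p < p := Nat.sqrt_lt_self hp
    have hsq' : (Nat.sqrt p : ℝ) < p := by exact_mod_cast hsq
    refine re_dyadicMean_le fun i hi => ?_
    rw [hγ]
    have h2 := le_log_two_pow_add_two (p - Nat.sqrt p + i)
    have h5 : ((p : ℝ) - Nat.sqrt p) * Real.log 2 ≤
        Real.log (1 + ((2 ^ (p - Nat.sqrt p + i) + 1 : ℕ) : ℝ)) := by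
      refine le_trans ?_ h2
      gcongr
      push_cast [Nat.cast_sub hsq.le]
      linarith [(Nat.cast_nonneg i : (0 : ℝ) ≤ i)]
    have h6 : 0 < ((p : ℝ) - Nat.sqrt p) * Real.log 2 := mul_pos (by linarith) hl2
    have h7 : (p : ℝ) - Nat.sqrt p ≠ 0 := by linarith
    calc S (2 ^ (p - Nat.sqrt p + i) + 1) / Real.log (1 + ((2 ^ (p - Nat.sqrt p + i) + 1 : ℕ) : ℝ))
        ≤ S (2 ^ p + 1) / (((p : ℝ) - Nat.sqrt p) * Real.log 2) := by
          refine div_le_div₀ (hS0 _) (hS ?_) h6 h5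
          exact Nat.succ_le_succ (Nat.pow_le_pow_right two_pos (by omega))
      _ = _ := by
          rw [show (1 : ℝ) - Nat.sqrt p / p = (p - Nat.sqrt p) / p by field_simp]
          field_simp
  rwa [le_antisymm hup hdown] at hl

/-- Monotonicity of S fills in the values between powers of two; consecutive dyadic logarithms have
ratio tending to 1. -/
theorem tendsto_of_tendsto_dyadic (hS : Monotone S) (hS0 : ∀ k, 0 ≤ S k) {c : ℝ}
    (h : Tendsto (fun e : ℕ => S (2 ^ e + 1) / (e * Real.log 2)) atTop (𝓝 c)) :
    Tendsto (fun k : ℕ => S k / Real.log (1 + k)) atTop (𝓝 c) := by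
  have hl2 : 0 < Real.log 2 := Real.log_pos (by norm_num)
  have hlog : Tendsto (fun k : ℕ => Nat.log 2 k) atTop atTop :=
    tendsto_atTop.2 fun m => by
      filter_upwards [eventually_ge_atTop (2 ^ m)] with k hk
      exact Nat.le_log_of_pow_le (by norm_num) hk
  have hinv : Tendsto (fun e : ℕ => 1 / ((e : ℝ) + 1)) atTop (𝓝 0) :=
    tendsto_one_div_add_atTop_nhds_zero_nat
  have hup : Tendsto (fun e : ℕ => S (2 ^ (e + 1) + 1) / (((e + 1 : ℕ) : ℝ) * Real.log 2) *
      (1 + 1 / (e : ℝ))) atTop (𝓝 c) := by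
    simpa using (h.comp (tendsto_add_atTop_nat 1)).mul
      (tendsto_one_div_atTop_nhds_zero_nat.const_add (1 : ℝ))
  -- With 2^e ≤ k, the index 2^e + 1 may exceed k, so the lower bound steps back to e - 1. The last
  -- factor is (e - 1)/(e + 1).
  have hlo : Tendsto (fun e : ℕ => S (2 ^ (e - 1) + 1) / (((e - 1 : ℕ) : ℝ) * Real.log 2) *
      (1 - 2 * (1 / ((e : ℝ) + 1)))) atTop (𝓝 c) := by
    simpa using (h.comp (tendsto_sub_atTop_nat 1)).mul ((hinv.const_mul 2).const_sub (1 : ℝ))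
  refine tendsto_of_tendsto_of_tendsto_of_le_of_le' (hlo.comp hlog) (hup.comp hlog) ?_ ?_
  · filter_upwards [eventually_ge_atTop 4] with k hk
    simp only [Function.comp_def]
    obtain ⟨e, he⟩ : ∃ e, Nat.log 2 k = e + 2 :=
      ⟨Nat.log 2 k - 2, by have := Nat.le_log_of_pow_le (b := 2) (x := 2) (by norm_num) hk; omega⟩
    have h1 : 2 ^ (e + 2) ≤ k := he ▸ Nat.pow_log_le_self 2 (by omega)
    have h2 : k < 2 ^ (e + 2 + 1) := he ▸ Nat.lt_pow_succ_log_self (by norm_num) k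
    rw [he, show e + 2 - 1 = e + 1 by omega]
    have h3 : Real.log (1 + k) ≤ (e + 3) * Real.log 2 := by
      have : ((e : ℝ) + 3) * Real.log 2 = Real.log (2 ^ (e + 3)) := by
        rw [Real.log_pow]; push_cast; ring
      rw [this]
      refine Real.log_le_log (by positivity) ?_
      have : k < 2 ^ (e + 3) := h2
      have : 1 + k ≤ 2 ^ (e + 3) := by omega
      exact_mod_cast this
    have h4 : 0 < Real.log (1 + k) := Real.log_pos (by
      have : (4 : ℝ) ≤ k := by exact_mod_cast hk
      linarith)
    calc S (2 ^ (e + 1) + 1) / (((e + 1 : ℕ) : ℝ) * Real.log 2) *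
          (1 - 2 * (1 / (((e + 2 : ℕ) : ℝ) + 1)))
        = S (2 ^ (e + 1) + 1) / ((e + 3) * Real.log 2) := by
          push_cast; field_simp; ring_nf
      _ ≤ S k / Real.log (1 + k) := by
          refine div_le_div₀ (hS0 _) (hS ?_) h4 h3
          have : 2 ^ (e + 2) = 2 * 2 ^ (e + 1) := by ring
          have := Nat.one_le_two_pow (n := e + 1)
          omega
  · filter_upwards [eventually_ge_atTop 4] with k hk
    simp only [Function.comp_def]
    obtain ⟨e, he⟩ : ∃ e, Nat.log 2 k = e + 2 :=
      ⟨Nat.log 2 k - 2, by have := Nat.le_log_of_pow_le (b := 2) (x := 2) (by norm_num) hk; omega⟩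
    have h1 : 2 ^ (e + 2) ≤ k := he ▸ Nat.pow_log_le_self 2 (by omega)
    have h2 : k < 2 ^ (e + 2 + 1) := he ▸ Nat.lt_pow_succ_log_self (by norm_num) k
    rw [he]
    have h3 : (e + 2) * Real.log 2 ≤ Real.log (1 + k) := by
      have : ((e : ℝ) + 2) * Real.log 2 = Real.log (2 ^ (e + 2)) := by
        rw [Real.log_pow]; push_cast; ring
      rw [this]
      refine Real.log_le_log (by positivity) ?_
      have : 2 ^ (e + 2) ≤ 1 + k := by omega
      exact_mod_cast this
    calc S k / Real.log (1 + k) ≤ S (2 ^ (e + 2 + 1) + 1) / ((e + 2) * Real.log 2) :=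
          div_le_div₀ (hS0 _) (hS (by omega)) (by positivity) h3
      _ = _ := by push_cast; field_simp

end Tauberian

/-! ### Measurability forces convergence of γ(T) -/

section Dixmier

variable {H : Type*} [NormedAddCommGroup H] [InnerProductSpace ℂ H]

theorem MemL1Inf.exists_sum_singVal_le {T : H →L[ℂ] H} (hT : MemL1Inf T) :
    ∃ C, ∀ k : ℕ, ∑ j ∈ Finset.range k, singVal T j ≤ C * Real.log (1 + k) := by
  refine ⟨‖(⟨gammaSeq T, hT.2⟩ : EllInfty)‖, fun k => ?_⟩
  cases k with
  | zero => simp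
  | succ i =>
    have h := norm_apply_le ⟨gammaSeq T, hT.2⟩ i
    have h1 : ‖gammaSeq T i‖ ≤ ‖(⟨gammaSeq T, hT.2⟩ : EllInfty)‖ := h
    have hlog : 0 < Real.log (1 + ((i + 1 : ℕ) : ℝ)) := Real.log_pos (by
      push_cast; linarith [(Nat.cast_nonneg i : (0 : ℝ) ≤ i)])
    rw [gammaSeq, Complex.norm_real] at h1
    have h2 := (le_abs_self _).trans h1
    rwa [inv_mul_le_iff₀ hlog, mul_comm] at h2

variable [CompleteSpace H]

/-- For a measurable operator the sequence `γ(T)` converges. -/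
theorem IsMeasurableOp.exists_tendsto {T : H →L[ℂ] H} {hT : MemL1Inf T}
    (hm : IsMeasurableOp T hT) :
    ∃ c : ℝ, 0 ≤ c ∧ Tendsto (fun k : ℕ => (∑ j ∈ Finset.range k, singVal T j) / Real.log (1 + k))
      atTop (𝓝 c) := by
  obtain ⟨c, hc⟩ := hm
  obtain ⟨C, hC⟩ := hT.exists_sum_singVal_le
  have hS : Monotone fun k : ℕ => ∑ j ∈ Finset.range k, singVal T j :=
    monotone_nat_of_le_succ fun k => by
      rw [Finset.sum_range_succ]; linarith [singVal_nonneg T k]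
  have hS0 : ∀ k : ℕ, 0 ≤ ∑ j ∈ Finset.range k, singVal T j := fun k =>
    Finset.sum_nonneg fun j _ => singVal_nonneg T j
  have h := tendsto_of_tendsto_dyadic hS hS0 <|
    tendsto_dyadic_of_means hS hS0 hC (γ := ⟨gammaSeq T, hT.2⟩) (c := c.re)
      (fun i => by
        change (gammaSeq T i).re = _
        rw [gammaSeq, Complex.ofReal_re, div_eq_inv_mul])
      fun U hU w hw => by
        obtain ⟨ω, hω⟩ := exists_tendsto_dyadicMean U w
        rw [← hc ω (isDL2_of_tendsto_dyadicMean hU hw hω H)]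
        exact (Complex.continuous_re.tendsto _).comp (hω _)
  refine ⟨c.re, ge_of_tendsto' h fun k => div_nonneg (hS0 k) (Real.log_nonneg ?_), h⟩
  linarith [(Nat.cast_nonneg k : (0 : ℝ) ≤ k)]

end Dixmier

/-! ### The operators R M_f R on the torus -/

section Torus

variable {n : ℕ}

instance : IsProbabilityMeasure (torusMeasure n) := by
  unfold torusMeasure; infer_instance

theorem expBasis_eq_toLp (m : Fin n → ℤ) :
    expBasis n m = ContinuousMap.toLp 2 (torusMeasure n) ℂ (UnitAddTorus.mFourier m) :=
  congrFun (UnitAddTorus.coe_mFourierBasis (d := Fin n)) m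

theorem conj_mFourier_mul_self (m : Fin n → ℤ) (x : UnitAddTorus (Fin n)) :
    conj (UnitAddTorus.mFourier m x) * UnitAddTorus.mFourier m x = 1 := by
  rw [← UnitAddTorus.mFourier_neg, ← UnitAddTorus.mFourier_add, neg_add_cancel,
    UnitAddTorus.mFourier_zero]
  rfl

/-- A diagonal operator with square summable entries maps `L²` to `L^∞`. -/
theorem ae_norm_diagonalOp_le {r : (Fin n → ℤ) → ℂ} {C : ℝ} (hC : ∀ m, ‖r m‖ ≤ C)
    (hr : Summable fun m => ‖r m‖ ^ 2) (u : L2Torus n) :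
    ∀ᵐ x ∂torusMeasure n,
      ‖diagonalOp (expBasis n) r u x‖ ≤ √(∑' m, ‖r m‖ ^ 2) * ‖u‖ := by
  set b := expBasis n
  set d : (Fin n → ℤ) → ℂ := fun m => r m * ⟪b m, u⟫_ℂ with hd
  have hu := hasSum_norm_inner_sq b u
  -- Cauchy–Schwarz: the Fourier coefficients of the image are absolutely summable, so its series
  -- converges uniformly.
  have hle : ∀ s : Finset (Fin n → ℤ), ∑ m ∈ s, ‖d m‖ ≤ √(∑' m, ‖r m‖ ^ 2) * ‖u‖ := fun s => by
    refine le_of_sq_le_sq ?_ (by positivity)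
    rw [mul_pow, Real.sq_sqrt (tsum_nonneg fun m => sq_nonneg _)]
    simp_rw [hd, norm_mul]
    refine (Finset.sum_mul_sq_le_sq_mul_sq s _ _).trans ?_
    exact mul_le_mul (hr.sum_le_tsum s fun m _ => sq_nonneg _)
      (sum_le_hasSum s (fun m _ => sq_nonneg _) hu) (Finset.sum_nonneg fun m _ => sq_nonneg _)
      (tsum_nonneg fun m => sq_nonneg _)
  have hd1 : Summable fun m => ‖d m‖ := summable_of_sum_le (fun m => norm_nonneg _) hle
  have hnorm : ∀ m, ‖d m • UnitAddTorus.mFourier m‖ = ‖d m‖ := fun m => by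
    rw [norm_smul, UnitAddTorus.mFourier_norm, mul_one]
  have hsum : Summable fun m => ‖d m • UnitAddTorus.mFourier m‖ := by simpa only [hnorm] using hd1
  have h1 := (ContinuousMap.toLp 2 (torusMeasure n) ℂ).hasSum hsum.of_norm.hasSum
  have h2 := b.hasSum_repr (diagonalOp b r u)
  have h3 : diagonalOp b r u =
      ContinuousMap.toLp 2 (torusMeasure n) ℂ (∑' m, d m • UnitAddTorus.mFourier m) := by
    refine h2.unique ?_
    convert h1 using 1
    ext1 m
    rw [b.repr_apply_apply, inner_diagonalOp b hC, map_smul, ← expBasis_eq_toLp]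
  rw [h3]
  filter_upwards [ContinuousMap.coeFn_toLp (p := 2) (𝕜 := ℂ) (torusMeasure n)
    (∑' m, d m • UnitAddTorus.mFourier m)] with x hx
  rw [hx]
  refine (ContinuousMap.norm_coe_le_norm _ x).trans ((norm_tsum_le_tsum_norm hsum).trans ?_)
  simp_rw [hnorm]
  exact Real.tsum_le_of_sum_le (fun m => norm_nonneg _) hle

variable {R : L2Torus n →L[ℂ] L2Torus n}

theorem IsSymmProd.add {f g : UnitAddTorus (Fin n) → ℂ} {S T : L2Torus n →L[ℂ] L2Torus n}
    (hf : IsSymmProd R f S) (hg : IsSymmProd R g T) :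
    IsSymmProd R (fun x => f x + g x) (S + T) := fun u v => by
  have h : (fun x => conj (R u x) * (f x + g x) * R v x) =
      fun x => conj (R u x) * f x * R v x + conj (R u x) * g x * R v x := by
    ext x; ring
  rw [h]
  refine ⟨(hf u v).1.add (hg u v).1, ?_⟩
  rw [integral_add (hf u v).1 (hg u v).1, ← (hf u v).2, ← (hg u v).2, add_apply,
    inner_add_right]

theorem IsSymmProd.smul {f : UnitAddTorus (Fin n) → ℂ} {S : L2Torus n →L[ℂ] L2Torus n}
    (hf : IsSymmProd R f S) (c : ℂ) : IsSymmProd R (fun x => c * f x) (c • S) := fun u v => by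
  have h : (fun x => conj (R u x) * (c * f x) * R v x) =
      fun x => c * (conj (R u x) * f x * R v x) := by
    ext x; ring
  rw [h]
  refine ⟨(hf u v).1.const_mul c, ?_⟩
  rw [integral_const_mul, ← (hf u v).2, smul_apply, inner_smul_right]

theorem IsSymmProd.symmProd_eq {f : UnitAddTorus (Fin n) → ℂ} {S : L2Torus n →L[ℂ] L2Torus n}
    (h : IsSymmProd R f S) : symmProd R f = S := by
  have hb : SymmBounded R f := ⟨S, h⟩
  rw [symmProd, dif_pos hb]
  exact hb.choose_spec.unique h

/-- If R maps L² to L^∞, then conj(R u) · f · R v is dominated by a multiple of |f|, and the form is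
a bounded sesquilinear form, hence given by an operator. -/
theorem exists_isSymmProd {K : ℝ} (hK : 0 ≤ K)
    (hR : ∀ u : L2Torus n, ∀ᵐ x ∂torusMeasure n, ‖R u x‖ ≤ K * ‖u‖)
    {f : UnitAddTorus (Fin n) → ℂ} (hf : Integrable f (torusMeasure n)) :
    ∃ S, IsSymmProd R f S := by
  have hbd : ∀ u v : L2Torus n, ∀ᵐ x ∂torusMeasure n,
      ‖conj (R u x) * f x * R v x‖ ≤ K * ‖u‖ * (K * ‖v‖) * ‖f x‖ := fun u v => by
    filter_upwards [hR u, hR v] with x hu hv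
    rw [norm_mul, norm_mul, RCLike.norm_conj, mul_right_comm]
    gcongr
  have hint : ∀ u v : L2Torus n,
      Integrable (fun x => conj (R u x) * f x * R v x) (torusMeasure n) := fun u v =>
    (hf.norm.const_mul (K * ‖u‖ * (K * ‖v‖))).mono'
      (((Complex.continuous_conj.comp_aestronglyMeasurable
        (Lp.aestronglyMeasurable (R u))).mul hf.aestronglyMeasurable).mul
        (Lp.aestronglyMeasurable (R v))) (hbd u v)
  let B : L2Torus n →L⋆[ℂ] L2Torus n →L[ℂ] ℂ :=
    LinearMap.mkContinuous₂
      (LinearMap.mk₂'ₛₗ (starRingEnd ℂ) (RingHom.id ℂ)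
        (fun u v => ∫ x, conj (R u x) * f x * R v x ∂torusMeasure n)
        (fun u u' v => by
          rw [← integral_add (hint u v) (hint u' v), map_add]
          refine integral_congr_ae ?_
          filter_upwards [Lp.coeFn_add (R u) (R u')] with x hx
          rw [hx, Pi.add_apply, map_add]; ring)
        (fun c u v => by
          rw [smul_eq_mul, ← integral_const_mul, map_smul]
          refine integral_congr_ae ?_
          filter_upwards [Lp.coeFn_smul c (R u)] with x hx
          rw [hx, Pi.smul_apply, smul_eq_mul, map_mul]; ring)
        (fun u v v' => by
          rw [← integral_add (hint u v) (hint u v'), map_add]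
          refine integral_congr_ae ?_
          filter_upwards [Lp.coeFn_add (R v) (R v')] with x hx
          rw [hx, Pi.add_apply]; ring)
        (fun c u v => by
          rw [smul_eq_mul, ← integral_const_mul, map_smul]
          refine integral_congr_ae ?_
          filter_upwards [Lp.coeFn_smul c (R v)] with x hx
          rw [hx, Pi.smul_apply, smul_eq_mul, RingHom.id_apply]; ring))
      (K * K * ∫ x, ‖f x‖ ∂torusMeasure n) fun u v => by
        rw [LinearMap.mk₂'ₛₗ_apply]
        refine (norm_integral_le_of_norm_le (hf.norm.const_mul _) (hbd u v)).trans_eq ?_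
        rw [integral_const_mul]
        ring
  -- The representing operator of `B` acts on the left argument; its adjoint acts on the right one,
  -- as `IsSymmProd` requires.
  refine ⟨ContinuousLinearMap.adjoint (InnerProductSpace.continuousLinearMapOfBilin B),
    fun u v => ⟨hint u v, ?_⟩⟩
  rw [ContinuousLinearMap.adjoint_inner_right,
    InnerProductSpace.continuousLinearMapOfBilin_apply]
  rfl

theorem IsSymmProd.nonneg {g : UnitAddTorus (Fin n) → ℝ} (hg : ∀ x, 0 ≤ g x)
    {S : L2Torus n →L[ℂ] L2Torus n} (h : IsSymmProd R (fun x => (g x : ℂ)) S) : 0 ≤ S := by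
  rw [ContinuousLinearMap.nonneg_iff_isPositive, ContinuousLinearMap.isPositive_iff_complex]
  intro v
  have h1 : ⟪S v, v⟫_ℂ = ((∫ x, g x * ‖R v x‖ ^ 2 ∂torusMeasure n : ℝ) : ℂ) := by
    rw [← inner_conj_symm, (h v v).2, ← integral_complex_ofReal]
    have : (fun x => conj (R v x) * (g x : ℂ) * R v x) =
        fun x => ((g x * ‖R v x‖ ^ 2 : ℝ) : ℂ) := by
      ext x
      rw [mul_right_comm, Complex.conj_mul']
      push_cast
      ring
    rw [this, integral_complex_ofReal, Complex.conj_ofReal]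
  rw [h1]
  exact ⟨by simp, by simpa using integral_nonneg fun x => mul_nonneg (hg x) (sq_nonneg _)⟩

theorem diagonalOp_expBasis_ae {r : (Fin n → ℤ) → ℂ} {C : ℝ} (hC : ∀ m, ‖r m‖ ≤ C)
    (m : Fin n → ℤ) :
    ∀ᵐ x ∂torusMeasure n, diagonalOp (expBasis n) r (expBasis n m) x =
      r m * UnitAddTorus.mFourier m x := by
  rw [diagonalOp_apply_basis _ r C hC]
  filter_upwards [Lp.coeFn_smul (r m) (expBasis n m), coeFn_expBasis n m] with x h1 h2
  rw [h1, Pi.smul_apply, h2, smul_eq_mul]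

theorem conj_mul_diagonalOp_expBasis_ae {r : (Fin n → ℤ) → ℂ} {C : ℝ} (hC : ∀ m, ‖r m‖ ≤ C)
    (m : Fin n → ℤ) (f : UnitAddTorus (Fin n) → ℂ) :
    (fun x => conj (diagonalOp (expBasis n) r (expBasis n m) x) * f x *
      diagonalOp (expBasis n) r (expBasis n m) x) =ᵐ[torusMeasure n]
      fun x => ((‖r m‖ ^ 2 : ℝ) : ℂ) * f x := by
  filter_upwards [diagonalOp_expBasis_ae hC m] with x hx
  rw [hx, map_mul, Complex.ofReal_pow, ← Complex.conj_mul']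
  linear_combination conj (r m) * r m * f x * conj_mFourier_mul_self m x

/-- The source of the factor ∫ f: since |h_m| = 1, the diagonal sees f only through its mean. -/
theorem IsSymmProd.inner_expBasis {r : (Fin n → ℤ) → ℂ} {C : ℝ} (hC : ∀ m, ‖r m‖ ≤ C)
    {f : UnitAddTorus (Fin n) → ℂ} {S : L2Torus n →L[ℂ] L2Torus n}
    (h : IsSymmProd (diagonalOp (expBasis n) r) f S) (m : Fin n → ℤ) :
    ⟪expBasis n m, S (expBasis n m)⟫_ℂ =
      ((‖r m‖ ^ 2 : ℝ) : ℂ) * ∫ x, f x ∂torusMeasure n := by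
  rw [(h _ _).2, integral_congr_ae (conj_mul_diagonalOp_expBasis_ae hC m f), integral_const_mul]

theorem exists_isSymmProd_isTraceClass {r : (Fin n → ℤ) → ℂ} {C : ℝ} (hC : ∀ m, ‖r m‖ ≤ C)
    (hr : Summable fun m => ‖r m‖ ^ 2) {f : UnitAddTorus (Fin n) → ℂ}
    (hf : Integrable f (torusMeasure n)) :
    ∃ S, IsSymmProd (diagonalOp (expBasis n) r) f S ∧ IsTraceClass S := by
  have key : ∀ g : UnitAddTorus (Fin n) → ℝ, (∀ x, 0 ≤ g x) → Integrable g (torusMeasure n) →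
      ∃ S, IsSymmProd (diagonalOp (expBasis n) r) (fun x => (g x : ℂ)) S ∧ IsTraceClass S := by
    intro g hg hgi
    obtain ⟨S, hS⟩ := exists_isSymmProd (Real.sqrt_nonneg _) (ae_norm_diagonalOp_le hC hr) hgi.ofReal
    refine ⟨S, hS, isTraceClass_of_nonneg (expBasis n) (hS.nonneg hg) ?_⟩
    simp_rw [hS.inner_expBasis hC]
    exact (Complex.ofRealCLM.summable hr).mul_right _
  obtain ⟨S₁, h₁, t₁⟩ := key (fun x => max (f x).re 0) (fun _ => le_max_right _ _) hf.re.pos_part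
  obtain ⟨S₂, h₂, t₂⟩ := key (fun x => max (-(f x).re) 0) (fun _ => le_max_right _ _) hf.re.neg_part
  obtain ⟨S₃, h₃, t₃⟩ := key (fun x => max (f x).im 0) (fun _ => le_max_right _ _) hf.im.pos_part
  obtain ⟨S₄, h₄, t₄⟩ := key (fun x => max (-(f x).im) 0) (fun _ => le_max_right _ _) hf.im.neg_part
  refine ⟨(S₁ + (-1 : ℂ) • S₂) + Complex.I • (S₃ + (-1 : ℂ) • S₄), ?_,
    (t₁.add (t₂.smul _)).add ((t₃.add (t₄.smul _)).smul _)⟩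
  convert (h₁.add (h₂.smul (-1))).add ((h₃.add (h₄.smul (-1))).smul Complex.I) using 1
  ext x
  have hmax : ∀ t : ℝ, max t 0 - max (-t) 0 = t := fun t => by
    rcases le_total t 0 with h | h
    · rw [max_eq_right h, max_eq_left (by linarith)]; ring
    · rw [max_eq_left h, max_eq_right (by linarith)]; ring
  apply Complex.ext
  · simp [← sub_eq_add_neg, hmax]
  · simp [← sub_eq_add_neg, hmax]

end Torus

/-! ### Powers of G(Δ) -/

section Laplacian

variable {n : ℕ} {G : ℝ → ℝ}

theorem exists_norm_rpow_le (hG0 : ∀ x, 0 ≤ G x) (hGb : ∃ C : ℝ, ∀ x, G x ≤ C) {s : ℝ}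
    (hs : 0 ≤ s) : ∃ C : ℝ, ∀ m : Fin n → ℤ, ‖((G (eigenvalue m) ^ s : ℝ) : ℂ)‖ ≤ C := by
  obtain ⟨C, hC⟩ := hGb
  refine ⟨C ^ s, fun m => ?_⟩
  rw [Complex.norm_real, Real.norm_of_nonneg (Real.rpow_nonneg (hG0 _) _)]
  exact Real.rpow_le_rpow (hG0 _) (hC _) hs

theorem norm_rpow_half_sq (hG0 : ∀ x, 0 ≤ G x) (s : ℝ) (m : Fin n → ℤ) :
    ‖((G (eigenvalue m) ^ (s / 2) : ℝ) : ℂ)‖ ^ 2 = G (eigenvalue m) ^ s := by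
  rw [Complex.norm_real, Real.norm_of_nonneg (Real.rpow_nonneg (hG0 _) _), ← Real.rpow_natCast,
    ← Real.rpow_mul (hG0 _)]
  congr 1
  push_cast
  ring

theorem inner_powLaplacian (hG0 : ∀ x, 0 ≤ G x) (hGb : ∃ C : ℝ, ∀ x, G x ≤ C) {s : ℝ}
    (hs : 0 ≤ s) (m : Fin n → ℤ) :
    ⟪expBasis n m, powLaplacian n G s (expBasis n m)⟫_ℂ = ((G (eigenvalue m) ^ s : ℝ) : ℂ) := by
  obtain ⟨C, hC⟩ := exists_norm_rpow_le (n := n) hG0 hGb hs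
  rw [powLaplacian, funLaplacian, inner_diagonalOp (expBasis n) hC, inner_self_eq_norm_sq_to_K,
    (expBasis n).orthonormal.1 m]
  simp

theorem isTraceClass_powLaplacian (hG0 : ∀ x, 0 ≤ G x) (hGb : ∃ C : ℝ, ∀ x, G x ≤ C) {s : ℝ}
    (hs : 0 ≤ s) (hsum : Summable fun m : Fin n → ℤ => G (eigenvalue m) ^ s) :
    IsTraceClass (powLaplacian n G s) := by
  obtain ⟨C, hC⟩ := hGb
  refine isTraceClass_of_nonneg (expBasis n) (diagonalOp_nonneg (expBasis n) (C := C ^ s)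
    (fun m => Real.rpow_le_rpow (hG0 _) (hC _) hs) fun m => Real.rpow_nonneg (hG0 _) _) ?_
  have := Complex.ofRealCLM.summable hsum
  refine this.congr fun m => ?_
  exact (inner_powLaplacian hG0 ⟨C, hC⟩ hs m).symm

theorem exists_symmProd_powLaplacian (hG0 : ∀ x, 0 ≤ G x) (hGb : ∃ C : ℝ, ∀ x, G x ≤ C) {s : ℝ}
    (hs : 0 ≤ s) (hsum : Summable fun m : Fin n → ℤ => G (eigenvalue m) ^ s)
    {f : UnitAddTorus (Fin n) → ℂ} (hf : Integrable f (torusMeasure n)) :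
    SymmTraceClass n G s f ∧
      trace (expBasis n) (symmProd (powLaplacian n G (s / 2)) f) =
        ((∑' m : Fin n → ℤ, G (eigenvalue m) ^ s : ℝ) : ℂ) * ∫ x, f x ∂torusMeasure n := by
  obtain ⟨C, hC⟩ := exists_norm_rpow_le (n := n) hG0 hGb (div_nonneg hs zero_le_two)
  obtain ⟨S, hS, hT⟩ := exists_isSymmProd_isTraceClass hC
    (by simpa only [norm_rpow_half_sq hG0] using hsum) hf
  have hS' : IsSymmProd (powLaplacian n G (s / 2)) f S := hS
  refine ⟨⟨⟨S, hS'⟩, hS'.symmProd_eq ▸ hT⟩, ?_⟩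
  rw [hS'.symmProd_eq, trace]
  simp_rw [hS.inner_expBasis hC, norm_rpow_half_sq hG0]
  rw [tsum_mul_right, Complex.ofReal_tsum]

theorem exists_pos_of_funLaplacian_pos (hG0 : ∀ x, 0 ≤ G x) (hpos : 0 < funLaplacian n G) :
    ∃ m : Fin n → ℤ, 0 < G (eigenvalue m) := by
  by_contra! h
  have h0 : ∀ m : Fin n → ℤ, G (eigenvalue m) = 0 := fun m => le_antisymm (h m) (hG0 _)
  refine hpos.ne' (norm_le_zero_iff.1 ?_)
  exact norm_diagonalOp_le (expBasis n) le_rfl fun m => by rw [h0]; simp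

/-- At u = v = h_m the form's integrand is G(λ_m)^s |f|. One m with G(λ_m) > 0 suffices, and only
absolute convergence of the form is used, not the trace class property. -/
theorem integrable_of_symmBounded (hG0 : ∀ x, 0 ≤ G x) (hGb : ∃ C : ℝ, ∀ x, G x ≤ C)
    (hpos : 0 < funLaplacian n G) {s : ℝ} (hs : 0 ≤ s) {f : UnitAddTorus (Fin n) → ℂ}
    (hfm : AEStronglyMeasurable f (torusMeasure n))
    (h : SymmBounded (powLaplacian n G (s / 2)) fun x => (‖f x‖ : ℂ)) :
    Integrable f (torusMeasure n) := by
  obtain ⟨m, hm⟩ := exists_pos_of_funLaplacian_pos hG0 hpos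
  obtain ⟨C, hC⟩ := exists_norm_rpow_le (n := n) hG0 hGb (div_nonneg hs zero_le_two)
  obtain ⟨S, hS⟩ := h
  have h1 := ((hS (expBasis n m) (expBasis n m)).1.congr
    (conj_mul_diagonalOp_expBasis_ae hC m fun x => (‖f x‖ : ℂ))).norm
  rw [norm_rpow_half_sq hG0] at h1
  have hp : 0 < G (eigenvalue m) ^ s := Real.rpow_pos_of_pos hm s
  refine (integrable_norm_iff hfm).1 ((h1.const_mul (G (eigenvalue m) ^ s)⁻¹).congr ?_)
  refine Eventually.of_forall fun x => ?_
  simp only [norm_mul, Complex.norm_real, norm_norm, Real.norm_of_nonneg hp.le]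
  field_simp

end Laplacian

end TorusResidue

/-! ### The corollary -/

open TorusResidue
theorem corollary5p6 (n : ℕ) (G : ℝ → ℝ) (hGm : Measurable G) (hG0 : ∀ x, 0 ≤ G x)
    (hGb : ∃ C : ℝ, ∀ x, G x ≤ C)
    (hpos : 0 < funLaplacian n G)
    (hmem : MemL1Inf (funLaplacian n G))
    (hmeas : IsMeasurableOp (funLaplacian n G) hmem) :
    (∀ f : UnitAddTorus (Fin n) → ℂ, AEStronglyMeasurable f (torusMeasure n) →
      ((∀ s : ℝ, 1 < s → SymmTraceClass n G s (fun x => (‖f x‖ : ℂ))) ↔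
        Integrable f (torusMeasure n))) ∧
    (∀ s : ℝ, 1 < s → IsTraceClass (powLaplacian n G s)) ∧
    ∃ c : ℝ, 0 ≤ c ∧ Tendsto (zetaSeq n G) atTop (𝓝 (c : ℂ)) ∧
      ∀ f : UnitAddTorus (Fin n) → ℂ, Integrable f (torusMeasure n) →
        (∀ s : ℝ, 1 < s → SymmTraceClass n G s f) ∧
        Tendsto (symmZetaSeq n G f) atTop (𝓝 ((c : ℂ) * ∫ x, f x ∂torusMeasure n)) ∧
        ∃ hb : Memℓp (symmZetaSeq n G f) ∞,
          ∀ bl : EllInfty →L[ℂ] ℂ, IsBanachLimit bl →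
            bl ⟨symmZetaSeq n G f, hb⟩ = (c : ℂ) * ∫ x, f x ∂torusMeasure n := by
  obtain ⟨C, hC⟩ := hmem.exists_sum_singVal_le
  obtain ⟨c, hc0, hc⟩ := hmeas.exists_tendsto
  have hanti := singVal_antitone (funLaplacian n G)
  have hnn := singVal_nonneg (funLaplacian n G)
  have hzero := tendsto_zero_of_sum_le_log hanti hnn hC
  have hsum : ∀ s : ℝ, 1 < s → HasSum (fun m : Fin n → ℤ => G (eigenvalue m) ^ s)
      (∑' j, singVal (funLaplacian n G) j ^ s) := fun s hs =>
    hasSum_rpow_of_hasSum_singVal (expBasis n) (fun m => hGb.choose_spec (eigenvalue m))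
      (fun m => hG0 _) hzero (by linarith) (summable_rpow_of_sum_le_log hanti hnn hC hs).hasSum
  have hexp : ∀ i : ℕ, (1 : ℝ) < 1 + 1 / ((i + 1 : ℕ) : ℝ) := fun i =>
    lt_add_of_pos_right _ (by positivity)
  have hsymm := fun (s : ℝ) (hs : 1 < s) (f : UnitAddTorus (Fin n) → ℂ)
      (hf : Integrable f (torusMeasure n)) =>
    exists_symmProd_powLaplacian hG0 hGb (by linarith) (hsum s hs).summable hf
  have hz : Tendsto (fun i : ℕ => ((1 / ((i + 1 : ℕ) : ℝ) *
      ∑' m : Fin n → ℤ, G (eigenvalue m) ^ (1 + 1 / ((i + 1 : ℕ) : ℝ)) : ℝ) : ℂ)) atTop (𝓝 c) := by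
    refine (Complex.continuous_ofReal.tendsto c).comp ?_
    refine (tendsto_zeta_of_tendsto_gamma hanti hnn hC hc).congr fun i => ?_
    rw [(hsum _ (hexp i)).tsum_eq]
  refine ⟨fun f hfm => ⟨fun h => ?_, fun hf s hs => (hsymm s hs _ hf.norm.ofReal).1⟩,
    fun s hs => isTraceClass_powLaplacian hG0 hGb (by linarith) (hsum s hs).summable,
    c, hc0, hz.congr fun i => ?_, fun f hf => ?_⟩
  -- A single exponent is enough for the converse; s = 2 is an arbitrary choice.
  · exact integrable_of_symmBounded hG0 hGb hpos zero_le_two hfm (h 2 one_lt_two).1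
  · simp only [zetaSeq, trace]
    simp_rw [inner_powLaplacian hG0 hGb (zero_le_one.trans (hexp i).le)]
    rw [← Complex.ofReal_tsum, ← Complex.ofReal_mul]
  · have hlim : Tendsto (symmZetaSeq n G f) atTop (𝓝 ((c : ℂ) * ∫ x, f x ∂torusMeasure n)) := by
      refine (hz.mul_const _).congr fun i => ?_
      simp only [symmZetaSeq]
      rw [(hsymm _ (hexp i) f hf).2, Complex.ofReal_mul, mul_assoc]
    have hb : Memℓp (symmZetaSeq n G f) ∞ := memℓp_infty (by
      simpa using hlim.norm.bddAbove_range)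
    exact ⟨fun s hs => (hsymm s hs f hf).1, hlim, hb, fun bl hbl => hbl.apply_of_tendsto hlim⟩
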